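/- Throughout, $n\ge 1$ is an integer, $1<p<\infty$, $1\le q\le\infty$, and $U\subset\mathbf R^n$ is open. For a measurable $f$ on $U$ (real- or vector-valued, $|f|$ being the Euclidean length) let $\lambda_{[f]}(v)=|\{x\in U:|f(x)|>v\}|$, $f^*(t)=\inf\{v:\lambda_{[f]}(v)\le t\}$, $f^{**}(t)=\frac1t\int_0^t f^*(s)\,ds$, and $$\|f\|_{(p,q)}=\Big(\int_0^\infty \big(t^{1/p}f^{**}(t)\big)^q\,\frac{dt}{t}\Big)^{1/q}\ (q<\infty),\qquad \|f\|_{(p,\infty)}=\sup_{t>0}t^{1/p}f^{**}(t).$$ $L^{(p,q)}(U;\mathbf R^m)$ is the space of (a.e. classes of) measurable $f:U\to\mathbf R^m$ with $\|f\|_{(p,q)}<\infty$; we write $L^{(p,q)}(U)$ when $m=1$. Let $r=\min(p,q)$. * $H^{1,(p,q)}(U)$ is the completion of $\{\varphi\in C^\infty(U):\|\varphi\|_{1,(p,q);U}<\infty\}$ in the norm $\|\varphi\|_{1,(p,q);U}=(\|\varphi\|_{(p,q)}^r+\|\nabla\varphi\|_{(p,q)}^r)^{1/r}$, that is, the closure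 of the set of pairs $(\varphi,\nabla\varphi)$ in $L^{(p,q)}(U)\times L^{(p,q)}(U;\mathbf R^n)$; an element $(u,\nabla u)$ is identified with the function $u$. * $H_0^{1,(p,q)}(U)$ is the closure of $C_0^\infty(U)$ in $H^{1,(p,q)}(U)$. * $W^{1,(p,q)}(U)$ is the space of $u\in L^{(p,q)}(U)$ whose weak partial derivatives $\partial_1u,\dots,\partial_nu$ exist and belong to $L^{(p,q)}(U)$, with norm $\|u\|_{(p,q)}+\sum_{i=1}^n\|\partial_iu\|_{(p,q)}$. Functions that agree almost everywhere are identified; in particular, functions on $\Omega$ and on $\Omega\setminus\{y\}$ are compared by restriction. **Theorem.** Let $\Omega\subset\mathbf R^n$ be an open set, where $n\ge1$ is an integer, let $y\in\Omega$ and $1<p<\infty$. (i) $H^{1,(p,\infty)}(\Omega)\subsetneq W^{1,(p,\infty)}(\Omega)\cap H^{1,(p,\infty)}(\Omega\setminus\{y\})$. (ii) $H^{1,(p,q)}(\Omega\setminus\{y\})\subsetneq H^{1,(p,\infty)}(\Omega\setminus\{y\})$ whenever $1\le q<\infty$. (iii) None of the spaces $H_0^{1,(p,\infty)}(\Omega)$,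 $H^{1,(p,\infty)}(\Omega)$ and $W^{1,(p,\infty)}(\Omega)$ is reflexive. -/

import Mathlib

open MeasureTheory Set Filter Topology
open scoped ENNReal ContDiff

noncomputable section

/-! ### Rearrangements and the Lorentz norm -/

/-- The distribution function `λ_{[f]}(v) = μ {x : |f x| > v}`. -/
def distributionFn {α ε : Type*} [MeasurableSpace α] [ENorm ε] (μ : Measure α) (f : α → ε)
    (v : ℝ≥0∞) : ℝ≥0∞ :=
  μ {x | v < ‖f x‖ₑ}

/-- The nonincreasing rearrangement `f^*(t) = inf {v : λ_{[f]}(v) ≤ t}`. -/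
def rearrangement {α ε : Type*} [MeasurableSpace α] [ENorm ε] (μ : Measure α) (f : α → ε)
    (t : ℝ) : ℝ≥0∞ :=
  sInf {v : ℝ≥0∞ | distributionFn μ f v ≤ ENNReal.ofReal t}

/-- The maximal function `f^{**}(t) = (1/t) ∫_0^t f^*(s) ds`, for `t > 0`. -/
def maximalRearrangement {α ε : Type*} [MeasurableSpace α] [ENorm ε] (μ : Measure α) (f : α → ε)
    (t : ℝ) : ℝ≥0∞ :=
  (ENNReal.ofReal t)⁻¹ * ∫⁻ s in Ioo 0 t, rearrangement μ f s

/-- The Lorentz norm `‖f‖_{(p,q)}`, with values in `[0, ∞]`. -/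
def lorentzENorm {α ε : Type*} [MeasurableSpace α] [ENorm ε] (p : ℝ) (q : ℝ≥0∞) (μ : Measure α)
    (f : α → ε) : ℝ≥0∞ :=
  if q = ⊤ then
    ⨆ t ∈ Ioi (0 : ℝ), ENNReal.ofReal t ^ (1 / p) * maximalRearrangement μ f t
  else
    (∫⁻ t in Ioi (0 : ℝ),
      (ENNReal.ofReal t ^ (1 / p) * maximalRearrangement μ f t) ^ q.toReal / ENNReal.ofReal t)
        ^ (1 / q.toReal)

section Rearrangement

variable {α ε : Type*} [MeasurableSpace α] [ENorm ε] {μ : Measure α}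

theorem distributionFn_antitone (f : α → ε) : Antitone (distributionFn μ f) :=
  fun _ _ h => measure_mono fun _ hx => lt_of_le_of_lt h hx

theorem rearrangement_antitone (f : α → ε) : Antitone (rearrangement μ f) := fun _ _ h =>
  sInf_le_sInf fun _ hv => le_trans hv (ENNReal.ofReal_le_ofReal h)

theorem rearrangement_le_iff (f : α → ε) (s : ℝ) (v : ℝ≥0∞) :
    rearrangement μ f s ≤ v ↔ distributionFn μ f v ≤ ENNReal.ofReal s := by
  refine ⟨fun h => ?_, fun h => sInf_le h⟩
  rcases eq_or_ne v ⊤ with rfl | hv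
  · simp [distributionFn]
  obtain ⟨w, hw, hwv, hlim⟩ := exists_seq_strictAnti_tendsto' (lt_top_iff_ne_top.2 hv)
  have hU : {x | v < ‖f x‖ₑ} = ⋃ n, {x | w n < ‖f x‖ₑ} := by
    ext x
    simp only [mem_ofPred_eq, mem_iUnion]
    exact ⟨fun hx => (hlim.eventually (gt_mem_nhds hx)).exists,
      fun ⟨n, hn⟩ => (hwv n).1.trans hn⟩
  have hmono : Monotone fun n => {x | w n < ‖f x‖ₑ} :=
    fun m n hmn x hx => lt_of_le_of_lt (hw.antitone hmn) hx
  rw [distributionFn, hU, hmono.measure_iUnion]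
  refine iSup_le fun n => ?_
  obtain ⟨u, hu, hun⟩ := sInf_lt_iff.1 (lt_of_le_of_lt h (hwv n).1)
  exact (distributionFn_antitone f hun.le).trans hu

theorem lt_rearrangement_iff (f : α → ε) (s : ℝ) (v : ℝ≥0∞) :
    v < rearrangement μ f s ↔ ENNReal.ofReal s < distributionFn μ f v := by
  rw [← not_le, rearrangement_le_iff, not_le]

theorem volume_setOf_ofReal_lt (a : ℝ≥0∞) :
    volume.restrict (Ioi (0 : ℝ)) {v | ENNReal.ofReal v < a} = a := by
  rw [Measure.restrict_apply' measurableSet_Ioi]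
  rcases eq_or_ne a ⊤ with rfl | ha
  · simp
  · have : {v : ℝ | ENNReal.ofReal v < a} ∩ Ioi 0 = Ioo 0 a.toReal := by
      ext v
      simp only [mem_inter_iff, mem_ofPred_eq, mem_Ioi, mem_Ioo]
      constructor
      · rintro ⟨h1, h2⟩
        exact ⟨h2, (ENNReal.ofReal_lt_iff_lt_toReal h2.le ha).1 h1⟩
      · rintro ⟨h1, h2⟩
        exact ⟨(ENNReal.ofReal_lt_iff_lt_toReal h1.le ha).2 h2, h1⟩
    rw [this, Real.volume_Ioo, sub_zero, ENNReal.ofReal_toReal ha]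

theorem lintegral_layercake [SFinite μ] {g : α → ℝ≥0∞} (hg : Measurable g) :
    ∫⁻ x, g x ∂μ = ∫⁻ v in Ioi (0 : ℝ), μ {x | ENNReal.ofReal v < g x} := by
  have hm : MeasurableSet {z : α × ℝ | ENNReal.ofReal z.2 < g z.1} :=
    measurableSet_lt (by fun_prop) (by fun_prop)
  have h1 := Measure.prod_apply (μ := μ) (ν := volume.restrict (Ioi (0 : ℝ))) hm
  rw [Measure.prod_apply_symm hm] at h1
  refine Eq.trans (lintegral_congr fun x => ?_) h1.symm
  exact (volume_setOf_ofReal_lt (g x)).symm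

theorem lintegral_rearrangement [SFinite μ] {g : α → ℝ≥0∞} (hg : AEMeasurable g μ) :
    ∫⁻ s in Ioi (0 : ℝ), rearrangement μ g s = ∫⁻ x, g x ∂μ := by
  have h1 : ∀ v : ℝ≥0∞, distributionFn μ g v = μ {x | v < hg.mk g x} := fun v => by
    refine measure_congr (eventuallyEq_set.2 ?_)
    filter_upwards [hg.ae_eq_mk] with x hx
    simp [hx]
  rw [lintegral_congr_ae hg.ae_eq_mk, lintegral_layercake hg.measurable_mk,
    lintegral_layercake (rearrangement_antitone g).measurable]
  refine lintegral_congr fun v => ?_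
  rw [← h1]
  simp only [lt_rearrangement_iff]
  exact volume_setOf_ofReal_lt _

/-- `∫_0^t f^* ≤ ∫ (|f| - c)_+ + t c`. -/
theorem lintegral_rearrangement_le [SFinite μ] {f : α → ε} (hf : AEMeasurable (fun x => ‖f x‖ₑ) μ)
    (t : ℝ) (c : ℝ≥0∞) :
    ∫⁻ s in Ioo 0 t, rearrangement μ f s ≤ ∫⁻ x, (‖f x‖ₑ - c) ∂μ + ENNReal.ofReal t * c := by
  have hle : ∀ s, rearrangement μ f s ≤ rearrangement μ (fun x => ‖f x‖ₑ - c) s + c := fun s => by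
    rw [rearrangement_le_iff]
    have h := (rearrangement_le_iff (μ := μ) (fun x => ‖f x‖ₑ - c) s _).1 le_rfl
    refine le_trans (measure_mono fun x hx => ?_) h
    simpa [lt_tsub_iff_right] using hx
  calc ∫⁻ s in Ioo 0 t, rearrangement μ f s
      ≤ ∫⁻ s in Ioo 0 t, (rearrangement μ (fun x => ‖f x‖ₑ - c) s + c) := lintegral_mono hle
    _ = (∫⁻ s in Ioo 0 t, rearrangement μ (fun x => ‖f x‖ₑ - c) s) + ENNReal.ofReal t * c := by
        rw [lintegral_add_right _ measurable_const]
        simp [mul_comm]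
    _ ≤ _ := by
        refine add_le_add ?_ le_rfl
        rw [← lintegral_rearrangement (hf.sub_const c)]
        exact lintegral_mono_set Ioo_subset_Ioi_self

/-- Equality in the previous bound for `c = f^*(t)`. -/
theorem le_lintegral_rearrangement [SFinite μ] {f : α → ε}
    (hf : AEMeasurable (fun x => ‖f x‖ₑ) μ) (t : ℝ) :
    ∫⁻ x, (‖f x‖ₑ - rearrangement μ f t) ∂μ + ENNReal.ofReal t * rearrangement μ f t
      ≤ ∫⁻ s in Ioo 0 t, rearrangement μ f s := by
  set c := rearrangement μ f t with hc
  have h1 : ∀ s, rearrangement μ (fun x => ‖f x‖ₑ - c) s ≤ rearrangement μ f s - c := fun s => by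
    rw [rearrangement_le_iff]
    have h := (rearrangement_le_iff (μ := μ) f s _).1 le_rfl
    refine le_trans (measure_mono fun x hx => ?_) h
    simp only [mem_ofPred_eq, enorm_eq_self] at hx ⊢
    by_contra hcon
    exact absurd hx (not_lt.2 (tsub_le_tsub_right (not_lt.1 hcon) c))
  have h2 : ∀ s, t ≤ s → rearrangement μ (fun x => ‖f x‖ₑ - c) s = 0 := fun s hs => by
    have := h1 s
    rwa [tsub_eq_zero_of_le (rearrangement_antitone f hs), nonpos_iff_eq_zero] at this
  have h3 : ∫⁻ x, (‖f x‖ₑ - c) ∂μ ≤ ∫⁻ s in Ioo 0 t, (rearrangement μ f s - c) := by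
    rw [← lintegral_rearrangement (hf.sub_const c), ← lintegral_indicator measurableSet_Ioi,
      ← lintegral_indicator measurableSet_Ioo]
    refine lintegral_mono fun s => ?_
    by_cases hs : s ∈ Ioo 0 t
    · rw [indicator_of_mem hs, indicator_of_mem (Ioo_subset_Ioi_self hs)]
      exact h1 s
    · by_cases hs0 : s ∈ Ioi (0 : ℝ)
      · rw [indicator_of_mem hs0, h2 s (not_lt.1 fun h => hs ⟨hs0, h⟩)]
        exact zero_le
      · rw [indicator_of_notMem hs0]
        exact zero_le
  calc _ ≤ (∫⁻ s in Ioo 0 t, (rearrangement μ f s - c)) + ENNReal.ofReal t * c :=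
        add_le_add h3 le_rfl
    _ = ∫⁻ s in Ioo 0 t, (rearrangement μ f s - c + c) := by
        rw [lintegral_add_right _ measurable_const]
        simp [mul_comm]
    _ = _ := by
        refine setLIntegral_congr_fun measurableSet_Ioo fun s hs => ?_
        exact tsub_add_cancel_of_le (rearrangement_antitone f hs.2.le)

end Rearrangement

section LorentzENorm

variable {α F : Type*} [MeasurableSpace α] [NormedAddCommGroup F] {μ : Measure α}

theorem maximalRearrangement_add_le [SFinite μ] {f g : α → F} (hf : AEStronglyMeasurable f μ)
    (hg : AEStronglyMeasurable g μ) (t : ℝ) :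
    maximalRearrangement μ (f + g) t
      ≤ maximalRearrangement μ f t + maximalRearrangement μ g t := by
  simp only [maximalRearrangement]
  rw [← mul_add]
  gcongr
  set a := rearrangement μ f t with ha
  set b := rearrangement μ g t with hb
  have hsub : ∀ x, ‖(f + g) x‖ₑ - (a + b) ≤ (‖f x‖ₑ - a) + (‖g x‖ₑ - b) := fun x => by
    rw [tsub_le_iff_right]
    calc ‖(f + g) x‖ₑ ≤ ‖f x‖ₑ + ‖g x‖ₑ := enorm_add_le _ _
      _ ≤ (‖f x‖ₑ - a + a) + (‖g x‖ₑ - b + b) := add_le_add le_tsub_add le_tsub_add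
      _ = _ := by ring
  calc _ ≤ ∫⁻ x, (‖(f + g) x‖ₑ - (a + b)) ∂μ + ENNReal.ofReal t * (a + b) :=
        lintegral_rearrangement_le (hf.add hg).enorm t _
    _ ≤ ∫⁻ x, ((‖f x‖ₑ - a) + (‖g x‖ₑ - b)) ∂μ + ENNReal.ofReal t * (a + b) := by
        gcongr with x
        exact hsub x
    _ = (∫⁻ x, (‖f x‖ₑ - a) ∂μ + ENNReal.ofReal t * a)
          + (∫⁻ x, (‖g x‖ₑ - b) ∂μ + ENNReal.ofReal t * b) := by
        rw [lintegral_add_left' (hf.enorm.sub_const a)]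
        ring
    _ ≤ _ := add_le_add (le_lintegral_rearrangement hf.enorm t)
        (le_lintegral_rearrangement hg.enorm t)

theorem rearrangement_congr_enorm {f g : α → F} (h : ∀ᵐ x ∂μ, ‖f x‖ₑ = ‖g x‖ₑ) :
    rearrangement μ f = rearrangement μ g := by
  have : distributionFn μ f = distributionFn μ g := by
    ext v
    refine measure_congr (eventuallyEq_set.2 ?_)
    filter_upwards [h] with x hx
    simp [hx]
  funext t
  simp only [rearrangement, this]

theorem lorentzENorm_congr_enorm {p : ℝ} {q : ℝ≥0∞} {f g : α → F}
    (h : ∀ᵐ x ∂μ, ‖f x‖ₑ = ‖g x‖ₑ) : lorentzENorm p q μ f = lorentzENorm p q μ g := by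
  simp only [lorentzENorm, maximalRearrangement, rearrangement_congr_enorm h]

theorem lorentzENorm_congr_ae {p : ℝ} {q : ℝ≥0∞} {f g : α → F} (h : f =ᵐ[μ] g) :
    lorentzENorm p q μ f = lorentzENorm p q μ g :=
  lorentzENorm_congr_enorm (h.mono fun x hx => by rw [hx])

theorem measurable_maximalRearrangement (f : α → F) : Measurable (maximalRearrangement μ f) := by
  have h : Monotone fun t : ℝ => ∫⁻ s in Ioo 0 t, rearrangement μ f s :=
    fun a b hab => lintegral_mono_set (Ioo_subset_Ioo_right hab)
  exact (ENNReal.measurable_ofReal.inv).mul h.measurable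

theorem lorentzENorm_add_le [SFinite μ] {p : ℝ} {q : ℝ≥0∞} (hq : 1 ≤ q) {f g : α → F}
    (hf : AEStronglyMeasurable f μ) (hg : AEStronglyMeasurable g μ) :
    lorentzENorm p q μ (f + g) ≤ lorentzENorm p q μ f + lorentzENorm p q μ g := by
  unfold lorentzENorm
  split_ifs with hqt
  · refine iSup₂_le fun t ht => ?_
    calc _ ≤ ENNReal.ofReal t ^ (1 / p)
            * (maximalRearrangement μ f t + maximalRearrangement μ g t) := by
          gcongr
          exact maximalRearrangement_add_le hf hg t
      _ ≤ _ := by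
          rw [mul_add]
          exact add_le_add
            (le_iSup₂ (f := fun t (_ : t ∈ Ioi (0 : ℝ)) =>
              ENNReal.ofReal t ^ (1 / p) * maximalRearrangement μ f t) t ht)
            (le_iSup₂ (f := fun t (_ : t ∈ Ioi (0 : ℝ)) =>
              ENNReal.ofReal t ^ (1 / p) * maximalRearrangement μ g t) t ht)
  · have hq1 : 1 ≤ q.toReal := by
      rw [← ENNReal.toReal_one]
      exact ENNReal.toReal_mono hqt hq
    set ν : Measure ℝ := (volume.restrict (Ioi (0 : ℝ))).withDensity
      fun t => (ENNReal.ofReal t)⁻¹ with hν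
    have hmeas : ∀ h : α → F, Measurable fun t : ℝ =>
        ENNReal.ofReal t ^ (1 / p) * maximalRearrangement μ h t := fun h =>
      ((ENNReal.measurable_ofReal).pow_const _).mul (measurable_maximalRearrangement h)
    have hint : ∀ k : ℝ → ℝ≥0∞, Measurable k →
        ∫⁻ t in Ioi (0 : ℝ), k t ^ q.toReal / ENNReal.ofReal t = ∫⁻ t, k t ^ q.toReal ∂ν := by
      intro k hk
      have hd : Measurable fun t : ℝ => (ENNReal.ofReal t)⁻¹ := ENNReal.measurable_ofReal.inv
      rw [hν, lintegral_withDensity_eq_lintegral_mul _ hd (hk.pow_const _)]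
      refine lintegral_congr fun t => ?_
      rw [Pi.mul_apply, div_eq_mul_inv, mul_comm]
    rw [hint _ (hmeas _), hint _ (hmeas _), hint _ (hmeas _)]
    refine le_trans ?_ (ENNReal.lintegral_Lp_add_le (hmeas f).aemeasurable
      (hmeas g).aemeasurable hq1)
    gcongr with t
    simp only [Pi.add_apply]
    rw [← mul_add]
    gcongr
    exact maximalRearrangement_add_le hf hg t

theorem rearrangement_smul_le [NormedSpace ℝ F] (c : ℝ) (f : α → F) (s : ℝ) :
    rearrangement μ (c • f) s ≤ ‖c‖ₑ * rearrangement μ f s := by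
  rw [rearrangement_le_iff]
  refine le_trans (measure_mono fun x hx => ?_)
    ((rearrangement_le_iff (μ := μ) f s _).1 le_rfl)
  simp only [mem_ofPred_eq, Pi.smul_apply, enorm_smul] at hx ⊢
  exact lt_of_mul_lt_mul_left' hx

theorem lorentzENorm_smul_le [NormedSpace ℝ F] {p : ℝ} {q : ℝ≥0∞} (hq : 1 ≤ q) (c : ℝ)
    (f : α → F) : lorentzENorm p q μ (c • f) ≤ ‖c‖ₑ * lorentzENorm p q μ f := by
  have hmax : ∀ t, maximalRearrangement μ (c • f) t ≤ ‖c‖ₑ * maximalRearrangement μ f t := by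
    intro t
    simp only [maximalRearrangement]
    rw [mul_left_comm, ← lintegral_const_mul _ (rearrangement_antitone f).measurable]
    gcongr with s
    exact rearrangement_smul_le c f s
  unfold lorentzENorm
  split_ifs with hqt
  · simp only [ENNReal.mul_iSup]
    refine iSup₂_mono fun t ht => ?_
    rw [mul_left_comm]
    gcongr
    exact hmax t
  · have hq1 : 1 ≤ q.toReal := by
      rw [← ENNReal.toReal_one]
      exact ENNReal.toReal_mono hqt hq
    have hq0 : 0 < q.toReal := zero_lt_one.trans_le hq1
    calc _ ≤ (∫⁻ t in Ioi (0 : ℝ), ‖c‖ₑ ^ q.toReal *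
          ((ENNReal.ofReal t ^ (1 / p) * maximalRearrangement μ f t) ^ q.toReal
            / ENNReal.ofReal t)) ^ (1 / q.toReal) := by
          gcongr with t
          rw [← mul_div_assoc, ← ENNReal.mul_rpow_of_nonneg _ _ hq0.le, mul_left_comm]
          gcongr
          exact hmax t
      _ = _ := by
          rw [lintegral_const_mul' _ _ (by simp [hq0.le]),
            ENNReal.mul_rpow_of_nonneg _ _ (by positivity), ← ENNReal.rpow_mul,
            mul_one_div_cancel hq0.ne', ENNReal.rpow_one]

theorem lorentzENorm_zero {p : ℝ} {q : ℝ≥0∞} (hq : 1 ≤ q) :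
    lorentzENorm p q μ (0 : α → F) = 0 := by
  have hr : ∀ s, rearrangement μ (0 : α → F) s = 0 := fun s => by
    rw [← nonpos_iff_eq_zero, rearrangement_le_iff]
    simp [distributionFn]
  unfold lorentzENorm
  split_ifs with hqt
  · simp [maximalRearrangement, hr]
  · have hq0 : 0 < q.toReal := ENNReal.toReal_pos (zero_lt_one.trans_le hq).ne' hqt
    simp [maximalRearrangement, hr, hq0]

theorem ae_eq_zero_of_lorentzENorm_eq_zero {p : ℝ} {q : ℝ≥0∞} (hq : 1 ≤ q) {f : α → F}
    (h : lorentzENorm p q μ f = 0) : f =ᵐ[μ] 0 := by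
  have hae : ∀ᵐ t ∂(volume.restrict (Ioi (0 : ℝ))),
      ENNReal.ofReal t ^ (1 / p) * maximalRearrangement μ f t = 0 := by
    unfold lorentzENorm at h
    split_ifs at h with hqt
    · filter_upwards [ae_restrict_mem measurableSet_Ioi] with t ht
      simp only [ENNReal.iSup_eq_zero] at h
      exact h t ht
    · have hq0 : 0 < q.toReal := ENNReal.toReal_pos (zero_lt_one.trans_le hq).ne' hqt
      rw [ENNReal.rpow_eq_zero_iff_of_pos (by positivity), lintegral_eq_zero_iff] at h
      · filter_upwards [h, ae_restrict_mem measurableSet_Ioi] with t ht ht0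
        simpa [ENNReal.div_eq_zero_iff, hq0, ENNReal.rpow_eq_zero_iff_of_pos hq0] using ht
      · exact ((((ENNReal.measurable_ofReal).pow_const _).mul
          (measurable_maximalRearrangement f)).pow_const _).div ENNReal.measurable_ofReal
  have hz : ∀ s > 0, rearrangement μ f s = 0 := by
    intro s hs
    have hne : volume.restrict (Ioi (0 : ℝ)) (Ioi s) ≠ 0 := by
      rw [Measure.restrict_apply' measurableSet_Ioi, inter_eq_left.2 (Ioi_subset_Ioi hs.le)]
      simp
    obtain ⟨t, hst, ht⟩ : ∃ t ∈ Ioi s,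
        ENNReal.ofReal t ^ (1 / p) * maximalRearrangement μ f t = 0 := by
      by_contra! hcon
      exact hne (measure_mono_null (fun t ht => hcon t ht) (ae_iff.1 hae))
    have ht0 : 0 < t := hs.trans hst
    have h0 : ENNReal.ofReal t ≠ 0 := by simpa using ht0
    have hint : ∫⁻ s in Ioo 0 t, rearrangement μ f s = 0 := by
      rcases mul_eq_zero.1 ht with h1 | h1
      · exact absurd h1 (ENNReal.rpow_pos (pos_iff_ne_zero.2 h0) ENNReal.ofReal_ne_top).ne'
      · rcases mul_eq_zero.1 h1 with h2 | h2
        · simp at h2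
        · exact h2
    have hle : ∫⁻ _ in Ioo 0 s, rearrangement μ f s ≤ ∫⁻ s in Ioo 0 t, rearrangement μ f s :=
      (setLIntegral_mono' measurableSet_Ioo fun u hu => rearrangement_antitone f hu.2.le).trans
        (lintegral_mono_set (Ioo_subset_Ioo_right (le_of_lt hst)))
    rw [hint, nonpos_iff_eq_zero] at hle
    simpa [hs.not_ge] using hle
  have hd : distributionFn μ f 0 = 0 := by
    refine le_antisymm (ENNReal.le_of_forall_pos_le_add fun e he _ => ?_) zero_le
    have := (rearrangement_le_iff (μ := μ) f e 0).1 (hz e he).le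
    simpa using this
  rw [distributionFn] at hd
  have : ∀ᵐ x ∂μ, ¬ (0 < ‖f x‖ₑ) := by simpa [ae_iff] using hd
  filter_upwards [this] with x hx
  simpa using hx

end LorentzENorm

/-! ### The Lorentz spaces `L^{(p,q)}` -/

section LorentzSpace

variable {α : Type*} [MeasurableSpace α]

/-- `L^{(p,q)}(μ; F)`: classes modulo a.e. equality of measurable functions with
`‖f‖_{(p,q)} < ∞`. -/
def LorentzSpace (p : ℝ) (q : ℝ≥0∞) [hq : Fact (1 ≤ q)] (μ : Measure α) [SFinite μ]
    (F : Type*) [NormedAddCommGroup F] [NormedSpace ℝ F] : Submodule ℝ (α →ₘ[μ] F) where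
  carrier := {f | lorentzENorm p q μ f < ⊤}
  zero_mem' := by
    change lorentzENorm p q μ ((0 : α →ₘ[μ] F) : α → F) < ⊤
    rw [lorentzENorm_congr_ae AEEqFun.coeFn_zero, lorentzENorm_zero hq.out]
    exact ENNReal.zero_lt_top
  add_mem' := by
    intro f g hf hg
    change lorentzENorm p q μ ((f + g : α →ₘ[μ] F) : α → F) < ⊤
    rw [lorentzENorm_congr_ae (AEEqFun.coeFn_add f g)]
    exact (lorentzENorm_add_le hq.out f.aestronglyMeasurable g.aestronglyMeasurable).trans_lt
      (ENNReal.add_lt_top.2 ⟨hf, hg⟩)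
  smul_mem' := by
    intro c f hf
    change lorentzENorm p q μ ((c • f : α →ₘ[μ] F) : α → F) < ⊤
    rw [lorentzENorm_congr_ae (AEEqFun.coeFn_smul c f)]
    exact (lorentzENorm_smul_le hq.out c f).trans_lt (ENNReal.mul_lt_top enorm_lt_top hf)

variable {p : ℝ} {q : ℝ≥0∞} [hq : Fact (1 ≤ q)] {μ : Measure α} [SFinite μ]
  {F : Type*} [NormedAddCommGroup F] [NormedSpace ℝ F]

/-- The norm `‖·‖_{(p,q)}` on `L^{(p,q)}(μ; F)`. -/
instance LorentzSpace.instNormedAddCommGroup : NormedAddCommGroup (LorentzSpace p q μ F) :=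
  AddGroupNorm.toNormedAddCommGroup
    { toFun := fun f => (lorentzENorm p q μ (f : α →ₘ[μ] F)).toReal
      map_zero' := by
        rw [Submodule.coe_zero, lorentzENorm_congr_ae AEEqFun.coeFn_zero,
          lorentzENorm_zero hq.out, ENNReal.toReal_zero]
      add_le' := fun f g => by
        rw [Submodule.coe_add, lorentzENorm_congr_ae (AEEqFun.coeFn_add _ _),
          ← ENNReal.toReal_add f.2.ne g.2.ne]
        exact ENNReal.toReal_mono (ENNReal.add_lt_top.2 ⟨f.2, g.2⟩).ne
          (lorentzENorm_add_le hq.out f.1.aestronglyMeasurable g.1.aestronglyMeasurable)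
      neg' := fun f => by
        rw [Submodule.coe_neg, lorentzENorm_congr_enorm]
        filter_upwards [AEEqFun.coeFn_neg (f : α →ₘ[μ] F)] with x hx
        rw [hx, Pi.neg_apply, enorm_neg]
      eq_zero_of_map_eq_zero' := fun f hf => by
        have h0 : lorentzENorm p q μ (f : α →ₘ[μ] F) = 0 :=
          ((ENNReal.toReal_eq_zero_iff _).1 hf).resolve_right f.2.ne
        exact Subtype.ext (AEEqFun.ext
          ((ae_eq_zero_of_lorentzENorm_eq_zero hq.out h0).trans AEEqFun.coeFn_zero.symm)) }

theorem LorentzSpace.norm_def (f : LorentzSpace p q μ F) :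
    ‖f‖ = (lorentzENorm p q μ (f : α →ₘ[μ] F)).toReal := rfl

instance LorentzSpace.instNormedSpace : NormedSpace ℝ (LorentzSpace p q μ F) where
  norm_smul_le c f := by
    rw [LorentzSpace.norm_def, LorentzSpace.norm_def, Submodule.coe_smul,
      lorentzENorm_congr_ae (AEEqFun.coeFn_smul _ _), ← toReal_enorm c, ← ENNReal.toReal_mul]
    exact ENNReal.toReal_mono (ENNReal.mul_lt_top enorm_lt_top f.2).ne
      (lorentzENorm_smul_le hq.out c _)

theorem LorentzSpace.coeFn_zero :
    (((0 : LorentzSpace p q μ F) : α →ₘ[μ] F) : α → F) =ᵐ[μ] 0 := AEEqFun.coeFn_zero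

theorem LorentzSpace.coeFn_add (f g : LorentzSpace p q μ F) :
    (((f + g : LorentzSpace p q μ F) : α →ₘ[μ] F) : α → F)
      =ᵐ[μ] (f : α →ₘ[μ] F) + (g : α →ₘ[μ] F) := AEEqFun.coeFn_add _ _

theorem LorentzSpace.coeFn_smul (c : ℝ) (f : LorentzSpace p q μ F) :
    (((c • f : LorentzSpace p q μ F) : α →ₘ[μ] F) : α → F)
      =ᵐ[μ] c • ((f : α →ₘ[μ] F) : α → F) := AEEqFun.coeFn_smul _ _

end LorentzSpace

/-! ### Sobolev-Lorentz spaces -/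

/-- `L^{(p,q)}(Ω; F)` for an open set `Ω ⊆ ℝⁿ`. -/
abbrev LorentzOn {n : ℕ} (p : ℝ) (q : ℝ≥0∞) [Fact (1 ≤ q)]
    (Ω : TopologicalSpace.Opens (EuclideanSpace ℝ (Fin n)))
    (F : Type*) [NormedAddCommGroup F] [NormedSpace ℝ F] :=
  LorentzSpace p q (volume.restrict (Ω : Set (EuclideanSpace ℝ (Fin n)))) F

instance fact_one_le_min {p : ℝ} {q : ℝ≥0∞} [hp : Fact (1 < p)] [hq : Fact (1 ≤ q)] :
    Fact (1 ≤ min (ENNReal.ofReal p) q) :=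
  ⟨le_min (by simpa using hp.out.le) hq.out⟩

/-- `L^{(p,q)}(Ω) × L^{(p,q)}(Ω; ℝⁿ)` with the norm `(‖u‖^r + ‖g‖^r)^{1/r}`, `r = min(p,q)`. -/
abbrev LorentzPair {n : ℕ} (p : ℝ) (q : ℝ≥0∞) [Fact (1 ≤ q)]
    (Ω : TopologicalSpace.Opens (EuclideanSpace ℝ (Fin n))) :=
  WithLp (min (ENNReal.ofReal p) q)
    (LorentzOn p q Ω ℝ × LorentzOn p q Ω (EuclideanSpace ℝ (Fin n)))

section Gradient

variable {n : ℕ} {φ ψ : EuclideanSpace ℝ (Fin n) → ℝ} {x : EuclideanSpace ℝ (Fin n)}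

theorem gradient_zero_fun : gradient (0 : EuclideanSpace ℝ (Fin n) → ℝ) = 0 := by
  funext x
  simp [gradient]

theorem gradient_add_fun (h1 : DifferentiableAt ℝ φ x) (h2 : DifferentiableAt ℝ ψ x) :
    gradient (φ + ψ) x = gradient φ x + gradient ψ x := by
  simp only [gradient, fderiv_add h1 h2, map_add]

theorem gradient_smul_fun (c : ℝ) (h : DifferentiableAt ℝ φ x) :
    gradient (c • φ) x = c • gradient φ x := by
  simp only [gradient, fderiv_const_smul h c, map_smul]

theorem differentiableAt_of_smoothOn {Ω : TopologicalSpace.Opens (EuclideanSpace ℝ (Fin n))}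
    (h : ContDiffOn ℝ ∞ φ Ω) (hx : x ∈ (Ω : Set (EuclideanSpace ℝ (Fin n)))) :
    DifferentiableAt ℝ φ x :=
  (h.contDiffAt (Ω.isOpen.mem_nhds hx)).differentiableAt (by simp)

end Gradient

/-- The functions `φ ∈ C^∞(Ω)` with `‖φ‖_{1,(p,q);Ω} < ∞`, as pairs `(φ, ∇φ)`. -/
def smoothPairs {n : ℕ} (p : ℝ) (q : ℝ≥0∞) [Fact (1 ≤ q)]
    (Ω : TopologicalSpace.Opens (EuclideanSpace ℝ (Fin n))) :
    Submodule ℝ (LorentzPair p q Ω) where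
  carrier := {w | ∃ φ : EuclideanSpace ℝ (Fin n) → ℝ, ContDiffOn ℝ ∞ φ Ω ∧
    w.fst.1 =ᵐ[volume.restrict Ω] φ ∧ w.snd.1 =ᵐ[volume.restrict Ω] gradient φ}
  zero_mem' := ⟨0, contDiffOn_const, by
    rw [WithLp.zero_fst]
    exact LorentzSpace.coeFn_zero, by
    rw [WithLp.zero_snd, gradient_zero_fun]
    exact LorentzSpace.coeFn_zero⟩
  add_mem' := by
    rintro v w ⟨φ, hφ, h1, h2⟩ ⟨ψ, hψ, h3, h4⟩
    refine ⟨φ + ψ, hφ.add hψ, (LorentzSpace.coeFn_add v.fst w.fst).trans (h1.add h3),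
      (LorentzSpace.coeFn_add v.snd w.snd).trans ((h2.add h4).trans ?_)⟩
    filter_upwards [ae_restrict_mem Ω.isOpen.measurableSet] with x hx
    exact (gradient_add_fun (differentiableAt_of_smoothOn hφ hx)
      (differentiableAt_of_smoothOn hψ hx)).symm
  smul_mem' := by
    rintro c w ⟨φ, hφ, h1, h2⟩
    refine ⟨c • φ, hφ.const_smul c, (LorentzSpace.coeFn_smul c w.fst).trans (h1.const_smul c),
      (LorentzSpace.coeFn_smul c w.snd).trans ((h2.const_smul c).trans ?_)⟩
    filter_upwards [ae_restrict_mem Ω.isOpen.measurableSet] with x hx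
    exact (gradient_smul_fun c (differentiableAt_of_smoothOn hφ hx)).symm

/-- The functions `φ ∈ C_0^∞(Ω)`, as pairs `(φ, ∇φ)`. -/
def testPairs {n : ℕ} (p : ℝ) (q : ℝ≥0∞) [Fact (1 ≤ q)]
    (Ω : TopologicalSpace.Opens (EuclideanSpace ℝ (Fin n))) :
    Submodule ℝ (LorentzPair p q Ω) where
  carrier := {w | ∃ φ : EuclideanSpace ℝ (Fin n) → ℝ, ContDiff ℝ ∞ φ ∧ HasCompactSupport φ ∧
    tsupport φ ⊆ Ω ∧
    w.fst.1 =ᵐ[volume.restrict Ω] φ ∧ w.snd.1 =ᵐ[volume.restrict Ω] gradient φ}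
  zero_mem' := ⟨0, contDiff_const, HasCompactSupport.zero, by simp [tsupport], by
    rw [WithLp.zero_fst]
    exact LorentzSpace.coeFn_zero, by
    rw [WithLp.zero_snd, gradient_zero_fun]
    exact LorentzSpace.coeFn_zero⟩
  add_mem' := by
    rintro v w ⟨φ, hφ, hφc, hφs, h1, h2⟩ ⟨ψ, hψ, hψc, hψs, h3, h4⟩
    refine ⟨φ + ψ, hφ.add hψ, hφc.add hψc,
      (tsupport_add φ ψ).trans (union_subset hφs hψs),
      (LorentzSpace.coeFn_add v.fst w.fst).trans (h1.add h3),
      (LorentzSpace.coeFn_add v.snd w.snd).trans ((h2.add h4).trans (.of_forall fun x => ?_))⟩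
    exact (gradient_add_fun (hφ.differentiable (by simp) x)
      (hψ.differentiable (by simp) x)).symm
  smul_mem' := by
    rintro c w ⟨φ, hφ, hφc, hφs, h1, h2⟩
    refine ⟨c • φ, hφ.const_smul c, hφc.smul_left (f := fun _ => c),
      (tsupport_smul_subset_right (fun _ => c) φ).trans hφs,
      (LorentzSpace.coeFn_smul c w.fst).trans (h1.const_smul c),
      (LorentzSpace.coeFn_smul c w.snd).trans ((h2.const_smul c).trans (.of_forall fun x => ?_))⟩
    exact (gradient_smul_fun c (hφ.differentiable (by simp) x)).symm

/-- `H^{1,(p,q)}(Ω)`: the completion of `{φ ∈ C^∞(Ω) : ‖φ‖_{1,(p,q);Ω} < ∞}`, realised as the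
closure of the pairs `(φ, ∇φ)` in the Banach space `L^{(p,q)}(Ω) × L^{(p,q)}(Ω; ℝⁿ)`. -/
def SobolevLorentzH {n : ℕ} (p : ℝ) (q : ℝ≥0∞) [Fact (1 < p)] [Fact (1 ≤ q)]
    (Ω : TopologicalSpace.Opens (EuclideanSpace ℝ (Fin n))) : Submodule ℝ (LorentzPair p q Ω) :=
  (smoothPairs p q Ω).topologicalClosure

/-- `H_0^{1,(p,q)}(Ω)`: the closure of `C_0^∞(Ω)` in `H^{1,(p,q)}(Ω)`. (The latter is closed, so
the closure may be taken in `L^{(p,q)}(Ω) × L^{(p,q)}(Ω; ℝⁿ)`.) -/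
def SobolevLorentzH0 {n : ℕ} (p : ℝ) (q : ℝ≥0∞) [Fact (1 < p)] [Fact (1 ≤ q)]
    (Ω : TopologicalSpace.Opens (EuclideanSpace ℝ (Fin n))) : Submodule ℝ (LorentzPair p q Ω) :=
  (testPairs p q Ω).topologicalClosure

/-- `v ∈ L¹_loc(Ω)` is the `i`-th weak partial derivative of `u ∈ L¹_loc(Ω)`. -/
def IsWeakPartial {n : ℕ} (Ω : TopologicalSpace.Opens (EuclideanSpace ℝ (Fin n))) (i : Fin n)
    (u v : EuclideanSpace ℝ (Fin n) → ℝ) : Prop :=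
  LocallyIntegrableOn u Ω ∧ LocallyIntegrableOn v Ω ∧
    ∀ φ : EuclideanSpace ℝ (Fin n) → ℝ, ContDiff ℝ ∞ φ → HasCompactSupport φ → tsupport φ ⊆ Ω →
      ∫ x in Ω, φ x * v x = -∫ x in Ω, fderiv ℝ φ x (EuclideanSpace.single i 1) * u x

section WeakPartial

variable {n : ℕ} {Ω : TopologicalSpace.Opens (EuclideanSpace ℝ (Fin n))} {i : Fin n}
  {u v u' v' : EuclideanSpace ℝ (Fin n) → ℝ}

theorem locallyIntegrableOn_congr (hu : LocallyIntegrableOn u Ω)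
    (h : u =ᵐ[volume.restrict Ω] u') : LocallyIntegrableOn u' Ω := fun x hx => by
  obtain ⟨s, hs, hint⟩ := hu x hx
  refine ⟨s ∩ Ω, inter_mem hs self_mem_nhdsWithin, ?_⟩
  exact (hint.mono_set inter_subset_left).congr_fun_ae
    (ae_restrict_of_ae_restrict_of_subset inter_subset_right h)

theorem integrableOn_mul_of_locallyIntegrableOn {φ : EuclideanSpace ℝ (Fin n) → ℝ}
    (hu : LocallyIntegrableOn u Ω) (hφ : Continuous φ) (hc : HasCompactSupport φ)
    (hs : tsupport φ ⊆ Ω) : IntegrableOn (fun x => φ x * u x) Ω := by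
  have h := (hu.integrableOn_compact_subset hs hc).continuousOn_mul hφ.continuousOn hc
  refine (integrableOn_iff_integrable_of_support_subset (fun x hx => ?_)).1 h |>.integrableOn
  exact subset_tsupport φ (left_ne_zero_of_mul hx)

theorem IsWeakPartial.zero (Ω : TopologicalSpace.Opens (EuclideanSpace ℝ (Fin n))) (i : Fin n) :
    IsWeakPartial Ω i 0 0 :=
  ⟨locallyIntegrable_zero.locallyIntegrableOn _, locallyIntegrable_zero.locallyIntegrableOn _,
    fun φ _ _ _ => by simp⟩

theorem IsWeakPartial.congr (h : IsWeakPartial Ω i u v) (hu : u =ᵐ[volume.restrict Ω] u')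
    (hv : v =ᵐ[volume.restrict Ω] v') : IsWeakPartial Ω i u' v' := by
  refine ⟨locallyIntegrableOn_congr h.1 hu, locallyIntegrableOn_congr h.2.1 hv,
    fun φ h1 h2 h3 => ?_⟩
  have e1 : ∫ x in Ω, φ x * v' x = ∫ x in Ω, φ x * v x :=
    integral_congr_ae (hv.mono fun x hx => by simp only [hx])
  have e2 : ∫ x in Ω, fderiv ℝ φ x (EuclideanSpace.single i 1) * u' x =
      ∫ x in Ω, fderiv ℝ φ x (EuclideanSpace.single i 1) * u x :=
    integral_congr_ae (hu.mono fun x hx => by simp only [hx])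
  rw [e1, e2, h.2.2 φ h1 h2 h3]

theorem IsWeakPartial.add (h : IsWeakPartial Ω i u v) (h' : IsWeakPartial Ω i u' v') :
    IsWeakPartial Ω i (u + u') (v + v') := by
  refine ⟨h.1.add h'.1, h.2.1.add h'.2.1, fun φ h1 h2 h3 => ?_⟩
  have c1 : Continuous fun x => fderiv ℝ φ x (EuclideanSpace.single i 1) :=
    (h1.continuous_fderiv (by simp)).clm_apply continuous_const
  have c2 : HasCompactSupport fun x => fderiv ℝ φ x (EuclideanSpace.single i 1) :=
    h2.fderiv_apply ℝ _
  have c3 : tsupport (fun x => fderiv ℝ φ x (EuclideanSpace.single i 1)) ⊆ Ω :=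
    (tsupport_fderiv_apply_subset ℝ _).trans h3
  simp only [Pi.add_apply, mul_add]
  rw [integral_add (integrableOn_mul_of_locallyIntegrableOn h.2.1 h1.continuous h2 h3)
      (integrableOn_mul_of_locallyIntegrableOn h'.2.1 h1.continuous h2 h3),
    integral_add (integrableOn_mul_of_locallyIntegrableOn h.1 c1 c2 c3)
      (integrableOn_mul_of_locallyIntegrableOn h'.1 c1 c2 c3),
    h.2.2 φ h1 h2 h3, h'.2.2 φ h1 h2 h3]
  ring

theorem IsWeakPartial.smul (h : IsWeakPartial Ω i u v) (c : ℝ) :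
    IsWeakPartial Ω i (c • u) (c • v) := by
  refine ⟨h.1.smul c, h.2.1.smul c, fun φ h1 h2 h3 => ?_⟩
  simp only [Pi.smul_apply, smul_eq_mul, mul_left_comm _ c, integral_const_mul]
  rw [h.2.2 φ h1 h2 h3, mul_neg]

end WeakPartial

/-- `W^{1,(p,q)}(Ω)`: the functions `u ∈ L^{(p,q)}(Ω)` with weak derivatives
`∂_i u ∈ L^{(p,q)}(Ω)`, written as `(u, (∂_1 u, …, ∂_n u))`, with the norm
`‖u‖_{(p,q)} + ∑ i, ‖∂_i u‖_{(p,q)}`. -/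
def SobolevLorentzW {n : ℕ} (p : ℝ) (q : ℝ≥0∞) [Fact (1 ≤ q)]
    (Ω : TopologicalSpace.Opens (EuclideanSpace ℝ (Fin n))) :
    Submodule ℝ (WithLp 1 (LorentzOn p q Ω ℝ × PiLp 1 fun _ : Fin n => LorentzOn p q Ω ℝ)) where
  carrier := {w | ∀ i, IsWeakPartial Ω i w.fst.1 (w.snd i).1}
  zero_mem' := fun i =>
    (IsWeakPartial.zero Ω i).congr LorentzSpace.coeFn_zero.symm LorentzSpace.coeFn_zero.symm
  add_mem' := fun {v w} hv hw i => ((hv i).add (hw i)).congr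
    (LorentzSpace.coeFn_add v.fst w.fst).symm (LorentzSpace.coeFn_add (v.snd i) (w.snd i)).symm
  smul_mem' := fun c w hw i => ((hw i).smul c).congr
    (LorentzSpace.coeFn_smul c w.fst).symm (LorentzSpace.coeFn_smul c (w.snd i)).symm

/-- The real functions (defined on all of `ℝⁿ`, but only their values on `Ω` matter) whose class
on `Ω` belongs to `H^{1,(p,q)}(Ω)`. -/
def funH {n : ℕ} (p : ℝ) (q : ℝ≥0∞) [Fact (1 < p)] [Fact (1 ≤ q)]
    (Ω : TopologicalSpace.Opens (EuclideanSpace ℝ (Fin n))) : Set (EuclideanSpace ℝ (Fin n) → ℝ) :=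
  {u | ∃ w ∈ SobolevLorentzH p q Ω, u =ᵐ[volume.restrict Ω] w.fst.1}

/-- The real functions (defined on all of `ℝⁿ`, but only their values on `Ω` matter) whose class
on `Ω` belongs to `W^{1,(p,q)}(Ω)`. -/
def funW {n : ℕ} (p : ℝ) (q : ℝ≥0∞) [Fact (1 ≤ q)]
    (Ω : TopologicalSpace.Opens (EuclideanSpace ℝ (Fin n))) : Set (EuclideanSpace ℝ (Fin n) → ℝ) :=
  {u | ∃ w ∈ SobolevLorentzW p q Ω, u =ᵐ[volume.restrict Ω] w.fst.1}

/-- `Ω ∖ {y}`. -/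
def puncture {n : ℕ} (Ω : TopologicalSpace.Opens (EuclideanSpace ℝ (Fin n)))
    (y : EuclideanSpace ℝ (Fin n)) : TopologicalSpace.Opens (EuclideanSpace ℝ (Fin n)) :=
  ⟨(Ω : Set (EuclideanSpace ℝ (Fin n))) \ {y}, Ω.isOpen.sdiff isClosed_singleton⟩

/-- A normed space is reflexive if the canonical map into its bidual is onto. -/
def IsReflexiveSpace (X : Type*) [NormedAddCommGroup X] [NormedSpace ℝ X] : Prop :=
  Function.Surjective (NormedSpace.inclusionInDoubleDual ℝ X)

end


/-!
Let `u = ∑ₖ bₖ` with `bₖ(x) = rₖ^(1 - n/p) η((x - y)/rₖ)`, where `η` is a bump supported in an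
annulus around the origin and `rₖ = ρ / 4ᵏ`, so that the `bₖ` live in disjoint annuli shrinking to
`y`. Then `|u|` and `|∇u|` are bounded by a multiple of `|x - y|^(-n/p)`, a function of weak `L^p`.
The weights `wₖ(x) = rₖ^(n/p - n) (∂ᵢη)((x - y)/rₖ)` define functionals `Λₖ v = ∫ wₖ v` that are
bounded on `L^(p,∞)` uniformly in `k`, and `Λₖ(∂ᵢu) = ∫ (∂ᵢη)² > 0` for every `k`.

On the other hand `Λₖ(∂ᵢv) → 0` if `v` is smooth near `y`, hence, by uniform boundedness, for all
`v ∈ H^{1,(p,∞)}(Ω)`, and `Λₖ w → 0` for `w ∈ L^(p,q)` with `q < ∞`, because then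
`t^(1/p) w**(t) → 0` as `t → 0`; so `u` separates the spaces in (i) and (ii). The partial sums `S_N`
of the series are bounded in `H_0^{1,(p,∞)}(Ω)` and `Λₖ(∂ᵢS_N)` equals `∫ (∂ᵢη)²` for `N > k` and
`0` for `N ≤ k`. In a reflexive space a weak cluster point of `(S_N)`, which lies in the closed span
of the `S_N`, would satisfy `Λₖ(∂ᵢ ·) = ∫ (∂ᵢη)²` for all `k` and `Λₖ(∂ᵢ ·) → 0`.
-/

noncomputable section

section LorentzEstimates

variable {α β ε ε' : Type*} [MeasurableSpace α] [MeasurableSpace β] [ENorm ε] [ENorm ε']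
  {μ : Measure α} {ν : Measure β} {p : ℝ} {q : ℝ≥0∞}

/-- The function `t ↦ t^{1/p} f^{**}(t)`, whose `L^q(dt/t)` norm is the Lorentz norm of `f`. -/
def lorentzProfile (p : ℝ) (μ : Measure α) (f : α → ε) (t : ℝ) : ℝ≥0∞ :=
  ENNReal.ofReal t ^ (1 / p) * maximalRearrangement μ f t

theorem lorentzENorm_top (f : α → ε) :
    lorentzENorm p ⊤ μ f = ⨆ t ∈ Ioi (0 : ℝ), lorentzProfile p μ f t :=
  if_pos rfl

theorem lorentzENorm_of_ne_top (hq : q ≠ ⊤) (f : α → ε) :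
    lorentzENorm p q μ f = (∫⁻ t in Ioi (0 : ℝ),
      lorentzProfile p μ f t ^ q.toReal / ENNReal.ofReal t) ^ (1 / q.toReal) :=
  if_neg hq

theorem lorentzProfile_le_lorentzENorm_top (f : α → ε) {t : ℝ} (ht : 0 < t) :
    lorentzProfile p μ f t ≤ lorentzENorm p ⊤ μ f := by
  rw [lorentzENorm_top]
  exact le_iSup₂ (f := fun t (_ : t ∈ Ioi (0 : ℝ)) => lorentzProfile p μ f t) t ht

theorem lorentzENorm_mono_of_rearrangement_le {f : α → ε} {g : β → ε'}
    (h : ∀ s, rearrangement μ f s ≤ rearrangement ν g s) :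
    lorentzENorm p q μ f ≤ lorentzENorm p q ν g := by
  have hmax : ∀ t, maximalRearrangement μ f t ≤ maximalRearrangement ν g t := fun t => by
    unfold maximalRearrangement
    gcongr with s
    exact h s
  unfold lorentzENorm
  split_ifs <;> gcongr <;> exact hmax _

theorem lorentzENorm_mono_enorm {f : α → ε} {g : α → ε'} (h : ∀ᵐ x ∂μ, ‖f x‖ₑ ≤ ‖g x‖ₑ) :
    lorentzENorm p q μ f ≤ lorentzENorm p q μ g :=
  lorentzENorm_mono_of_rearrangement_le fun _ => sInf_le_sInf fun _ hv =>
    (measure_mono_ae (h.mono fun _ hx hv' => lt_of_lt_of_le hv' hx)).trans hv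

theorem lorentzENorm_mono_measure {ν : Measure α} (h : ν ≤ μ) (f : α → ε) :
    lorentzENorm p q ν f ≤ lorentzENorm p q μ f :=
  lorentzENorm_mono_of_rearrangement_le fun _ => sInf_le_sInf fun _ hv => (h _).trans hv

theorem lorentzENorm_comp_le {F G : Type*} [NormedAddCommGroup F] [NormedSpace ℝ F]
    [NormedAddCommGroup G] [NormedSpace ℝ G] (hq : 1 ≤ q) (ℓ : F →L[ℝ] G) (f : α → F) :
    lorentzENorm p q μ (ℓ ∘ f) ≤ ‖ℓ‖ₑ * lorentzENorm p q μ f := by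
  have hnorm : ∀ x, ‖(ℓ ∘ f) x‖ₑ ≤ ‖(‖ℓ‖ • f) x‖ₑ := fun x => by
    rw [Pi.smul_apply, enorm_smul, enorm_norm]
    exact ℓ.le_opENorm (f x)
  calc lorentzENorm p q μ (ℓ ∘ f) ≤ lorentzENorm p q μ (‖ℓ‖ • f) :=
        lorentzENorm_mono_enorm (.of_forall hnorm)
    _ ≤ ‖‖ℓ‖‖ₑ * lorentzENorm p q μ f := lorentzENorm_smul_le hq _ f
    _ = ‖ℓ‖ₑ * lorentzENorm p q μ f := by rw [enorm_norm]

theorem setLIntegral_enorm_le_lintegral_rearrangement [SFinite μ] {f : α → ε}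
    (hf : AEMeasurable (fun x => ‖f x‖ₑ) μ) {A : Set α} {t : ℝ} (hA : μ A ≤ ENNReal.ofReal t) :
    ∫⁻ x in A, ‖f x‖ₑ ∂μ ≤ ∫⁻ s in Ioo 0 t, rearrangement μ f s := by
  set c := rearrangement μ f t
  calc ∫⁻ x in A, ‖f x‖ₑ ∂μ ≤ ∫⁻ x in A, ((‖f x‖ₑ - c) + c) ∂μ := by
        gcongr with x
        exact le_tsub_add
    _ = ∫⁻ x in A, (‖f x‖ₑ - c) ∂μ + c * μ A := by
        rw [lintegral_add_right _ measurable_const, setLIntegral_const]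
    _ ≤ ∫⁻ x, (‖f x‖ₑ - c) ∂μ + ENNReal.ofReal t * c := by
        rw [mul_comm c]
        gcongr
        exact Measure.restrict_le_self
    _ ≤ _ := le_lintegral_rearrangement hf t

theorem lintegral_rearrangement_eq_rpow_mul_lorentzProfile (f : α → ε) {t : ℝ} (ht : 0 < t) :
    ∫⁻ s in Ioo 0 t, rearrangement μ f s =
      ENNReal.ofReal t ^ (1 - 1 / p) * lorentzProfile p μ f t := by
  have ht' : ENNReal.ofReal t ≠ 0 := by simpa using ht
  rw [lorentzProfile, ← mul_assoc, ← ENNReal.rpow_add _ _ ht' ENNReal.ofReal_ne_top,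
    sub_add_cancel, ENNReal.rpow_one, maximalRearrangement, ← mul_assoc,
    ENNReal.mul_inv_cancel ht' ENNReal.ofReal_ne_top, one_mul]

theorem lintegral_enorm_mul_le_lorentzProfile [SFinite μ] {ψ f : α → ℝ}
    (hf : AEMeasurable f μ) {C t : ℝ} (ht : 0 < t) (hC : ∀ x, ‖ψ x‖ ≤ C)
    (hψ : μ (Function.support ψ) ≤ ENNReal.ofReal t) :
    ∫⁻ x, ‖ψ x * f x‖ₑ ∂μ ≤
      ENNReal.ofReal C * ENNReal.ofReal t ^ (1 - 1 / p) * lorentzProfile p μ f t := by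
  have hsupp : (Function.support fun x => ‖ψ x * f x‖ₑ) ⊆ Function.support ψ := fun x hx => by
    contrapose! hx
    simp [Function.notMem_support.1 hx]
  calc ∫⁻ x, ‖ψ x * f x‖ₑ ∂μ = ∫⁻ x in Function.support ψ, ‖ψ x * f x‖ₑ ∂μ :=
        (setLIntegral_eq_of_support_subset hsupp).symm
    _ ≤ ∫⁻ x in Function.support ψ, ENNReal.ofReal C * ‖f x‖ₑ ∂μ := by
        gcongr with x
        rw [enorm_mul, ← ofReal_norm (ψ x)]
        gcongr
        exact hC x
    _ = ENNReal.ofReal C * ∫⁻ x in Function.support ψ, ‖f x‖ₑ ∂μ :=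
        lintegral_const_mul' _ _ ENNReal.ofReal_ne_top
    _ ≤ _ := by
        rw [mul_assoc, ← lintegral_rearrangement_eq_rpow_mul_lorentzProfile f ht]
        gcongr
        exact setLIntegral_enorm_le_lintegral_rearrangement hf.enorm hψ

theorem setLIntegral_Ioo_ofReal_rpow {a : ℝ} (ha : -1 < a) {t : ℝ} (ht : 0 < t) :
    ∫⁻ s in Ioo 0 t, ENNReal.ofReal s ^ a = ENNReal.ofReal (t ^ (a + 1) / (a + 1)) := by
  have hint : IntegrableOn (fun s : ℝ => s ^ a) (Ioo 0 t) := by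
    rw [← intervalIntegrable_iff_integrableOn_Ioo_of_le ht.le]
    exact intervalIntegral.intervalIntegrable_rpow' ha
  calc ∫⁻ s in Ioo 0 t, ENNReal.ofReal s ^ a = ∫⁻ s in Ioo 0 t, ENNReal.ofReal (s ^ a) :=
        setLIntegral_congr_fun measurableSet_Ioo fun s hs => ENNReal.ofReal_rpow_of_pos hs.1
    _ = ENNReal.ofReal (∫ s in Ioo 0 t, s ^ a) := by
        refine (ofReal_integral_eq_lintegral_ofReal hint ?_).symm
        filter_upwards [ae_restrict_mem measurableSet_Ioo] with s hs
        exact Real.rpow_nonneg hs.1.le a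
    _ = ENNReal.ofReal (t ^ (a + 1) / (a + 1)) := by
        rw [← integral_Ioc_eq_integral_Ioo, ← intervalIntegral.integral_of_le ht.le,
          integral_rpow (Or.inl ha), Real.zero_rpow (by linarith), sub_zero]

theorem lorentzENorm_top_le_of_rearrangement_le (hp : 1 < p) {f : α → ε} {B : ℝ≥0∞}
    (h : ∀ s > 0, rearrangement μ f s ≤ B * ENNReal.ofReal s ^ (-(1 / p))) :
    lorentzENorm p ⊤ μ f ≤ B * ENNReal.ofReal (1 - 1 / p)⁻¹ := by
  have hp0 : 0 < p := by positivity
  have hp1 : 1 / p < 1 := (div_lt_one hp0).2 hp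
  rw [lorentzENorm_top]
  refine iSup₂_le fun t (ht : 0 < t) => ?_
  have hint : ∫⁻ s in Ioo 0 t, rearrangement μ f s
      ≤ B * ENNReal.ofReal (t ^ (1 - 1 / p) / (1 - 1 / p)) :=
    calc ∫⁻ s in Ioo 0 t, rearrangement μ f s
        ≤ ∫⁻ s in Ioo 0 t, B * ENNReal.ofReal s ^ (-(1 / p)) :=
          setLIntegral_mono' measurableSet_Ioo fun s hs => h s hs.1
      _ = B * ENNReal.ofReal (t ^ (1 - 1 / p) / (1 - 1 / p)) := by
          rw [lintegral_const_mul _ (by fun_prop), setLIntegral_Ioo_ofReal_rpow (by linarith) ht,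
            neg_add_eq_sub]
  have hscale : t ^ (1 / p) * (t⁻¹ * (t ^ (1 - 1 / p) / (1 - 1 / p))) = (1 - 1 / p)⁻¹ := by
    rw [mul_div_assoc', mul_div_assoc', mul_left_comm, ← Real.rpow_add ht, add_sub_cancel,
      Real.rpow_one, inv_mul_cancel₀ ht.ne', one_div]
  calc lorentzProfile p μ f t
      ≤ ENNReal.ofReal t ^ (1 / p) * ((ENNReal.ofReal t)⁻¹ *
          (B * ENNReal.ofReal (t ^ (1 - 1 / p) / (1 - 1 / p)))) := by
        unfold lorentzProfile maximalRearrangement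
        gcongr
    _ = B * ENNReal.ofReal (t ^ (1 / p) * (t⁻¹ * (t ^ (1 - 1 / p) / (1 - 1 / p)))) := by
        rw [ENNReal.ofReal_mul (by positivity), ENNReal.ofReal_mul (by positivity),
          ENNReal.ofReal_inv_of_pos ht, ENNReal.ofReal_rpow_of_pos ht]
        ring
    _ = B * ENNReal.ofReal (1 - 1 / p)⁻¹ := by rw [hscale]

theorem half_mul_lorentzProfile_le (hp : 0 < p) (f : α → ε) {t τ : ℝ} (hτ : t ≤ τ)
    (hτ' : τ ≤ 2 * t) : 2⁻¹ * lorentzProfile p μ f t ≤ lorentzProfile p μ f τ := by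
  have hmax : 2⁻¹ * maximalRearrangement μ f t ≤ maximalRearrangement μ f τ := by
    have hτ2 : ENNReal.ofReal τ ≤ 2 * ENNReal.ofReal t := by
      rw [← ENNReal.ofReal_ofNat 2, ← ENNReal.ofReal_mul zero_le_two]
      exact ENNReal.ofReal_le_ofReal hτ'
    unfold maximalRearrangement
    rw [← mul_assoc, ← ENNReal.mul_inv (by simp) (by simp)]
    gcongr
  rw [lorentzProfile, mul_left_comm]
  unfold lorentzProfile
  gcongr

theorem lorentzProfile_le_setLIntegral (hp : 0 < p) (f : α → ε) {s : ℝ} (hs : 0 < s) {t : ℝ}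
    (ht : 0 < t) :
    lorentzProfile p μ f t ≤ 2 * (2 * ∫⁻ τ in Ioo t (2 * t),
      lorentzProfile p μ f τ ^ s / ENNReal.ofReal τ) ^ (1 / s) := by
  have ht' : ENNReal.ofReal t ≠ 0 := by simpa using ht
  have hint : (2⁻¹ * lorentzProfile p μ f t) ^ s ≤
      2 * ∫⁻ τ in Ioo t (2 * t), lorentzProfile p μ f τ ^ s / ENNReal.ofReal τ :=
    calc (2⁻¹ * lorentzProfile p μ f t) ^ s
        = 2 * ((2⁻¹ * lorentzProfile p μ f t) ^ s / (2 * ENNReal.ofReal t) *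
            ENNReal.ofReal t) := by
          rw [div_eq_mul_inv, ENNReal.mul_inv (by simp) (by simp), mul_assoc, mul_assoc,
            ENNReal.inv_mul_cancel ht' ENNReal.ofReal_ne_top, mul_one, mul_left_comm,
            ENNReal.mul_inv_cancel (by simp) (by simp), mul_one]
      _ = 2 * ∫⁻ _ in Ioo t (2 * t),
            (2⁻¹ * lorentzProfile p μ f t) ^ s / (2 * ENNReal.ofReal t) := by
          rw [setLIntegral_const, Real.volume_Ioo, two_mul t, add_sub_cancel_right]
      _ ≤ _ := by
          gcongr 2 * ?_
          refine setLIntegral_mono' measurableSet_Ioo fun τ hτ => ENNReal.div_le_div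
            (ENNReal.rpow_le_rpow (half_mul_lorentzProfile_le hp f hτ.1.le hτ.2.le) hs.le) ?_
          rw [← ENNReal.ofReal_ofNat 2, ← ENNReal.ofReal_mul zero_le_two]
          exact ENNReal.ofReal_le_ofReal hτ.2.le
  rw [← ENNReal.inv_mul_le_iff (by simp) (by simp), one_div]
  exact (ENNReal.le_rpow_inv_iff hs).2 hint

theorem lorentzENorm_top_le (hp : 0 < p) (hq : 1 ≤ q) (f : α → ε) :
    lorentzENorm p ⊤ μ f ≤ 2 * 2 ^ (1 / q.toReal) * lorentzENorm p q μ f := by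
  rcases eq_or_ne q ⊤ with rfl | hqt
  · simpa using le_mul_of_one_le_left' (one_le_two (α := ℝ≥0∞))
  have hq0 : 0 < q.toReal := ENNReal.toReal_pos (zero_lt_one.trans_le hq).ne' hqt
  rw [lorentzENorm_top, lorentzENorm_of_ne_top hqt, mul_assoc,
    ← ENNReal.mul_rpow_of_nonneg _ _ (by positivity)]
  refine iSup₂_le fun t (ht : 0 < t) => (lorentzProfile_le_setLIntegral hp f hq0 ht).trans ?_
  gcongr
  exact fun τ hτ => ht.trans hτ.1

theorem tendsto_lorentzProfile_zero (hp : 0 < p) (hq : 1 ≤ q) (hqt : q ≠ ⊤) {f : α → ε}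
    (hf : lorentzENorm p q μ f ≠ ⊤) : Tendsto (lorentzProfile p μ f) (𝓝[>] 0) (𝓝 0) := by
  have hq0 : 0 < q.toReal := ENNReal.toReal_pos (zero_lt_one.trans_le hq).ne' hqt
  have hfin : ∫⁻ t in Ioi (0 : ℝ), lorentzProfile p μ f t ^ q.toReal / ENNReal.ofReal t ≠ ⊤ := by
    contrapose! hf
    rw [lorentzENorm_of_ne_top hqt, hf, ENNReal.top_rpow_of_pos (by positivity)]
  have hvol : Tendsto (fun t : ℝ => (volume.restrict (Ioi (0 : ℝ))) (Ioo t (2 * t)))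
      (𝓝[>] 0) (𝓝 0) := by
    have h : Tendsto (fun t : ℝ => ENNReal.ofReal (2 * t - t)) (𝓝 0)
        (𝓝 (ENNReal.ofReal (2 * 0 - 0))) :=
      (ENNReal.continuous_ofReal.comp (by fun_prop)).tendsto _
    rw [mul_zero, sub_zero, ENNReal.ofReal_zero] at h
    exact tendsto_of_tendsto_of_tendsto_of_le_of_le tendsto_const_nhds
      (h.mono_left nhdsWithin_le_nhds) (fun _ => zero_le)
      fun t => (Measure.restrict_apply_le _ _).trans_eq Real.volume_Ioo
  have hbound : Tendsto (fun t : ℝ => 2 * (2 * ∫⁻ τ in Ioo t (2 * t), lorentzProfile p μ f τ ^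
      q.toReal / ENNReal.ofReal τ ∂(volume.restrict (Ioi (0 : ℝ)))) ^ (1 / q.toReal))
      (𝓝[>] 0) (𝓝 0) := by
    have h := ENNReal.Tendsto.const_mul ((ENNReal.Tendsto.const_mul
      (tendsto_setLIntegral_zero hfin hvol) (.inr (ENNReal.ofNat_ne_top (n := 2)))).ennrpow_const
        (1 / q.toReal)) (.inr (ENNReal.ofNat_ne_top (n := 2)))
    simpa only [mul_zero, ENNReal.zero_rpow_of_pos (one_div_pos.2 hq0)] using h
  refine tendsto_of_tendsto_of_tendsto_of_le_of_le' tendsto_const_nhds hbound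
    (.of_forall fun _ => zero_le) ?_
  filter_upwards [self_mem_nhdsWithin] with t (ht : 0 < t)
  rw [Measure.restrict_restrict measurableSet_Ioo,
    inter_eq_left.2 (Ioo_subset_Ioi_self.trans (Ioi_subset_Ioi ht.le))]
  exact lorentzProfile_le_setLIntegral hp f hq0 ht

end LorentzEstimates

section WeakPower

variable {E : Type*} [NormedAddCommGroup E] [NormedSpace ℝ E] [FiniteDimensional ℝ E]
  [Nontrivial E] [MeasurableSpace E] [BorelSpace E]

theorem lorentzENorm_top_dist_rpow_lt_top (μ : Measure E) [μ.IsAddHaarMeasure] {p : ℝ}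
    (hp : 1 < p) (y : E) :
    lorentzENorm p ⊤ μ (fun x => dist x y ^ (-(Module.finrank ℝ E / p : ℝ))) < ⊤ := by
  set d : ℝ := (Module.finrank ℝ E : ℝ) with hd
  set κ := (μ (Metric.ball (0 : E) 1)).toReal
  have hκ0 : 0 < κ :=
    ENNReal.toReal_pos (Metric.measure_ball_pos _ _ one_pos).ne' measure_ball_lt_top.ne
  have hd0 : 0 < d := Nat.cast_pos.2 Module.finrank_pos
  have hp0 : 0 < p := by positivity
  refine (lorentzENorm_top_le_of_rearrangement_le hp (B := ENNReal.ofReal (κ ^ (1 / p)))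
    fun s hs => ?_).trans_lt (ENNReal.mul_lt_top ENNReal.ofReal_lt_top ENNReal.ofReal_lt_top)
  set R := (s / κ) ^ d⁻¹
  have hR0 : 0 < R := Real.rpow_pos_of_pos (div_pos hs hκ0) _
  have hRd : R ^ d = s / κ := Real.rpow_inv_rpow (div_pos hs hκ0).le hd0.ne'
  have hRp : R ^ (-(d / p)) = κ ^ (1 / p) * s ^ (-(1 / p)) := by
    rw [neg_div', div_eq_mul_one_div, neg_mul, ← mul_neg, Real.rpow_mul hR0.le, hRd,
      Real.div_rpow hs.le hκ0.le, Real.rpow_neg hκ0.le, div_inv_eq_mul, mul_comm]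
  rw [ENNReal.ofReal_rpow_of_pos hs, ← ENNReal.ofReal_mul (by positivity), ← hRp,
    rearrangement_le_iff, distributionFn]
  have hsub : {x | ENNReal.ofReal (R ^ (-(d / p))) < ‖dist x y ^ (-(d / p))‖ₑ} ⊆
      Metric.ball y R := fun x hx => by
    contrapose! hx
    rw [Metric.mem_ball, not_lt] at hx
    rw [mem_ofPred_eq, not_lt, Real.enorm_of_nonneg (by positivity)]
    exact ENNReal.ofReal_le_ofReal
      (Real.rpow_le_rpow_of_nonpos hR0 hx (neg_nonpos.2 (by positivity)))
  calc _ ≤ μ (Metric.ball y R) := measure_mono hsub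
    _ = ENNReal.ofReal (R ^ d * κ) := by
        rw [Measure.addHaar_ball μ y hR0.le, ENNReal.ofReal_mul (by positivity),
          ENNReal.ofReal_toReal measure_ball_lt_top.ne, hd, Real.rpow_natCast]
    _ = ENNReal.ofReal s := by rw [hRd, div_mul_cancel₀ _ hκ0.ne']

end WeakPower

theorem quasiMeasurePreserving_id_of_le {α : Type*} [MeasurableSpace α] {μ ν : Measure α}
    (h : ν ≤ μ) : Measure.QuasiMeasurePreserving id ν μ :=
  ⟨measurable_id, Measure.absolutelyContinuous_of_le (Measure.map_id.trans_le h)⟩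

namespace LorentzSpace

variable {α : Type*} [MeasurableSpace α] {p p' : ℝ} {q q' : ℝ≥0∞} [hq : Fact (1 ≤ q)]
  [hq' : Fact (1 ≤ q')] {μ ν : Measure α} [SFinite μ] [SFinite ν]
  {F G : Type*} [NormedAddCommGroup F] [NormedSpace ℝ F] [NormedAddCommGroup G] [NormedSpace ℝ G]

theorem lorentzENorm_eq_enorm (v : LorentzSpace p q μ F) : lorentzENorm p q μ v.1 = ‖v‖ₑ := by
  rw [← ofReal_norm, norm_def, ENNReal.ofReal_toReal v.2.ne]

/-- The class in `L^{(p,q)}` of a function with finite Lorentz norm. -/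
def ofFun (f : α → F) (hf : AEStronglyMeasurable f μ) (h : lorentzENorm p q μ f < ⊤) :
    LorentzSpace p q μ F :=
  ⟨AEEqFun.mk f hf, (lorentzENorm_congr_ae (AEEqFun.coeFn_mk f hf)).trans_lt h⟩

theorem coeFn_ofFun (f : α → F) (hf : AEStronglyMeasurable f μ) (h : lorentzENorm p q μ f < ⊤) :
    (ofFun f hf h).1 =ᵐ[μ] f :=
  AEEqFun.coeFn_mk f hf

theorem enorm_ofFun (f : α → F) (hf : AEStronglyMeasurable f μ) (h : lorentzENorm p q μ f < ⊤) :
    ‖ofFun f hf h‖ₑ = lorentzENorm p q μ f := by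
  rw [← lorentzENorm_eq_enorm, lorentzENorm_congr_ae (coeFn_ofFun f hf h)]

/-- A linear map between spaces of classes of functions that is bounded for the Lorentz norms,
as a continuous linear map between Lorentz spaces. -/
def mapCLM (L : (α →ₘ[μ] F) →ₗ[ℝ] (α →ₘ[ν] G)) {K : ℝ≥0∞} (hK : K ≠ ⊤)
    (hL : ∀ f : α →ₘ[μ] F, lorentzENorm p' q' ν (L f) ≤ K * lorentzENorm p q μ f) :
    LorentzSpace p q μ F →L[ℝ] LorentzSpace p' q' ν G :=
  (L.restrict fun f hf => (hL f).trans_lt (ENNReal.mul_lt_top hK.lt_top hf)).mkContinuous K.toReal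
    fun f => by
      rw [norm_def, norm_def, ← ENNReal.toReal_mul]
      exact ENNReal.toReal_mono (ENNReal.mul_ne_top hK f.2.ne) (hL f)

/-- Composition with a continuous linear map, as an operator on Lorentz spaces. -/
def compCLM (p : ℝ) (q : ℝ≥0∞) [hq : Fact (1 ≤ q)] (μ : Measure α) [SFinite μ] (ℓ : F →L[ℝ] G) :
    LorentzSpace p q μ F →L[ℝ] LorentzSpace p q μ G :=
  mapCLM (K := ‖ℓ‖ₑ)
    { toFun := AEEqFun.comp ℓ ℓ.continuous
      map_add' := fun f g => AEEqFun.induction_on₂ f g fun f _ g _ =>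
        AEEqFun.mk_eq_mk.2 (.of_forall fun x => map_add ℓ (f x) (g x))
      map_smul' := fun c f => AEEqFun.induction_on f fun f _ =>
        AEEqFun.mk_eq_mk.2 (.of_forall fun x => map_smul ℓ c (f x)) }
    enorm_ne_top fun f =>
      (lorentzENorm_congr_ae (AEEqFun.coeFn_comp ℓ ℓ.continuous f)).trans_le
        (lorentzENorm_comp_le hq.out ℓ f)

theorem coeFn_compCLM (ℓ : F →L[ℝ] G) (v : LorentzSpace p q μ F) :
    (compCLM p q μ ℓ v).1 =ᵐ[μ] ℓ ∘ v.1 :=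
  AEEqFun.coeFn_comp ℓ ℓ.continuous v.1

/-- The inclusion `L^{(p,q)}(μ) → L^{(p,∞)}(ν)` for `ν ≤ μ`: it forgets the second exponent and,
when `ν` is a restriction of `μ`, restricts the functions to a subset. -/
def toWeak [hp : Fact (1 < p)] (h : ν ≤ μ) : LorentzSpace p q μ F →L[ℝ] LorentzSpace p ⊤ ν F :=
  mapCLM (K := 2 * 2 ^ (1 / q.toReal))
    { toFun := fun f => f.compQuasiMeasurePreserving id (quasiMeasurePreserving_id_of_le h)
      map_add' := fun f g => AEEqFun.induction_on₂ f g fun _ _ _ _ => rfl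
      map_smul' := fun _ f => AEEqFun.induction_on f fun _ _ => rfl }
    (by finiteness) fun f =>
      calc lorentzENorm p ⊤ ν (f.compQuasiMeasurePreserving id (quasiMeasurePreserving_id_of_le h))
        _ = lorentzENorm p ⊤ ν f :=
            lorentzENorm_congr_ae
              (AEEqFun.coeFn_compQuasiMeasurePreserving f (quasiMeasurePreserving_id_of_le h))
        _ ≤ lorentzENorm p ⊤ μ f := lorentzENorm_mono_measure h f
        _ ≤ _ := lorentzENorm_top_le (zero_lt_one.trans hp.out) hq.out f

theorem coeFn_toWeak [Fact (1 < p)] (h : ν ≤ μ) (v : LorentzSpace p q μ F) :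
    (toWeak h v).1 =ᵐ[ν] v.1 :=
  AEEqFun.coeFn_compQuasiMeasurePreserving v.1 (quasiMeasurePreserving_id_of_le h)

theorem compCLM_toWeak [Fact (1 < p)] (h : ν ≤ μ) (ℓ : F →L[ℝ] G) (v : LorentzSpace p q μ F) :
    compCLM p ⊤ ν ℓ (toWeak h v) = toWeak h (compCLM p q μ ℓ v) := by
  have hac := Measure.absolutelyContinuous_of_le h
  refine Subtype.ext (AEEqFun.ext ?_)
  filter_upwards [coeFn_compCLM ℓ (toWeak h v), coeFn_toWeak h v,
    coeFn_toWeak h (compCLM p q μ ℓ v), hac.ae_le (coeFn_compCLM ℓ v)] with x h1 h2 h3 h4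
  rw [h1, h3, h4, Function.comp_apply, Function.comp_apply, h2]

section Integral

theorem integrableOn (v : LorentzSpace p ⊤ μ F) {A : Set α} (hA : μ A ≠ ⊤) :
    IntegrableOn v.1 A μ := by
  refine ⟨v.1.aestronglyMeasurable.restrict, ?_⟩
  set t := (μ A).toReal + 1
  have ht : 0 < t := by positivity
  have hAt : μ A ≤ ENNReal.ofReal t :=
    (ENNReal.le_ofReal_iff_toReal_le hA ht.le).2 (le_add_of_nonneg_right zero_le_one)
  calc ∫⁻ x in A, ‖v.1 x‖ₑ ∂μ ≤ ∫⁻ s in Ioo 0 t, rearrangement μ v.1 s :=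
        setLIntegral_enorm_le_lintegral_rearrangement v.1.aestronglyMeasurable.enorm hAt
    _ = ENNReal.ofReal t ^ (1 - 1 / p) * lorentzProfile p μ v.1 t :=
        lintegral_rearrangement_eq_rpow_mul_lorentzProfile v.1 ht
    _ < ⊤ := ENNReal.mul_lt_top
        (ENNReal.rpow_ne_top_of_ne_zero (ENNReal.ofReal_pos.2 ht).ne' ENNReal.ofReal_ne_top).lt_top
        ((lorentzProfile_le_lorentzENorm_top _ ht).trans_lt v.2)

theorem norm_integral_mul_le {ψ : α → ℝ} {C t : ℝ} (hC : 0 ≤ C) (ht : 0 < t) (hψC : ∀ x, ‖ψ x‖ ≤ C)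
    (hsupp : μ (Function.support ψ) ≤ ENNReal.ofReal t) (v : LorentzSpace p ⊤ μ ℝ) :
    ‖∫ x, ψ x * v.1 x ∂μ‖ ≤ C * t ^ (1 - 1 / p) * ‖v‖ := by
  have h := calc ‖∫ x, ψ x * v.1 x ∂μ‖ₑ ≤ ∫⁻ x, ‖ψ x * v.1 x‖ₑ ∂μ :=
        enorm_integral_le_lintegral_enorm _
    _ ≤ ENNReal.ofReal C * ENNReal.ofReal t ^ (1 - 1 / p) * lorentzProfile p μ v.1 t :=
        lintegral_enorm_mul_le_lorentzProfile v.1.aemeasurable ht hψC hsupp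
    _ ≤ ENNReal.ofReal C * ENNReal.ofReal t ^ (1 - 1 / p) * ‖v‖ₑ := by
        rw [← lorentzENorm_eq_enorm]
        gcongr
        exact lorentzProfile_le_lorentzENorm_top _ ht
  rwa [← ofReal_norm, ← ofReal_norm, ENNReal.ofReal_rpow_of_pos ht,
    ← ENNReal.ofReal_mul hC, ← ENNReal.ofReal_mul (by positivity),
    ENNReal.ofReal_le_ofReal_iff (by positivity)] at h

variable [TopologicalSpace α] [IsFiniteMeasureOnCompacts μ]
  {ψ : α → ℝ}

theorem locallyIntegrable [WeaklyLocallyCompactSpace α] (v : LorentzSpace p ⊤ μ F) :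
    LocallyIntegrable v.1 μ := fun x =>
  let ⟨K, hK, hKx⟩ := exists_compact_mem_nhds x
  ⟨K, hKx, integrableOn v hK.measure_ne_top⟩

variable [OpensMeasurableSpace α] [T2Space α] [WeaklyLocallyCompactSpace α]

theorem integrable_mul (hψ : Continuous ψ) (hc : HasCompactSupport ψ)
    (v : LorentzSpace p ⊤ μ ℝ) : Integrable (fun x => ψ x * v.1 x) μ :=
  (locallyIntegrable v).integrable_smul_left_of_hasCompactSupport hψ hc

/-- The functional `v ↦ ∫ ψ v` on `L^{(p,∞)}` for a continuous `ψ` with compact support. -/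
def weightedIntegral (p : ℝ) (μ : Measure α) [SFinite μ] [IsFiniteMeasureOnCompacts μ]
    (hψ : Continuous ψ) (hc : HasCompactSupport ψ) : StrongDual ℝ (LorentzSpace p ⊤ μ ℝ) :=
  LinearMap.mkContinuousOfExistsBound
    { toFun := fun v => ∫ x, ψ x * v.1 x ∂μ
      map_add' := fun v w => by
        rw [← integral_add (integrable_mul hψ hc v) (integrable_mul hψ hc w)]
        exact integral_congr_ae ((coeFn_add v w).mono fun x hx =>
          (congrArg (ψ x * ·) hx).trans (mul_add _ _ _))
      map_smul' := fun c v => by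
        rw [RingHom.id_apply, smul_eq_mul, ← integral_const_mul]
        exact integral_congr_ae ((coeFn_smul c v).mono fun x hx =>
          (congrArg (ψ x * ·) hx).trans (mul_left_comm _ _ _)) } <| by
    obtain ⟨C, hC⟩ := hc.exists_bound_of_continuous hψ
    have hfin : μ (Function.support ψ) ≠ ⊤ :=
      measure_ne_top_of_subset (subset_tsupport ψ) hc.isCompact.measure_ne_top
    exact ⟨_, norm_integral_mul_le (t := (μ (Function.support ψ)).toReal + 1)
      (le_max_right C 0) (by positivity) (fun x => (hC x).trans (le_max_left C 0))
      ((ENNReal.le_ofReal_iff_toReal_le hfin (by positivity)).2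
        (le_add_of_nonneg_right zero_le_one))⟩

theorem weightedIntegral_apply_of_ae_eq (hψ : Continuous ψ) (hc : HasCompactSupport ψ)
    {v : LorentzSpace p ⊤ μ ℝ} {f : α → ℝ} (h : v.1 =ᵐ[μ] f) :
    weightedIntegral p μ hψ hc v = ∫ x, ψ x * f x ∂μ :=
  integral_congr_ae (h.mono fun x hx => by simp only [hx])

theorem norm_weightedIntegral_le (hψ : Continuous ψ) (hc : HasCompactSupport ψ) {C t : ℝ}
    (hC : 0 ≤ C) (ht : 0 < t) (hψC : ∀ x, ‖ψ x‖ ≤ C)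
    (hsupp : μ (Function.support ψ) ≤ ENNReal.ofReal t) :
    ‖weightedIntegral p μ hψ hc‖ ≤ C * t ^ (1 - 1 / p) :=
  ContinuousLinearMap.opNorm_le_bound _ (by positivity) (norm_integral_mul_le hC ht hψC hsupp)

end Integral

end LorentzSpace

local notation "𝔼" n:max => EuclideanSpace ℝ (Fin n)

section PartialDerivatives

variable {n : ℕ} {i : Fin n} {Ω : TopologicalSpace.Opens (𝔼 n)} {φ ψ u : 𝔼 n → ℝ}

/-- The partial derivative `∂_i φ`. -/
abbrev partialDeriv (i : Fin n) (φ : 𝔼 n → ℝ) (x : 𝔼 n) : ℝ :=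
  fderiv ℝ φ x (EuclideanSpace.single i 1)

theorem gradient_apply (φ : 𝔼 n → ℝ) (x : 𝔼 n) (i : Fin n) :
    gradient φ x i = partialDeriv i φ x := by
  rw [partialDeriv, ← InnerProductSpace.toDual_symm_apply, EuclideanSpace.inner_single_right,
    gradient]
  simp

theorem norm_gradient (φ : 𝔼 n → ℝ) (x : 𝔼 n) : ‖gradient φ x‖ = ‖fderiv ℝ φ x‖ := by
  rw [gradient, LinearIsometryEquiv.norm_map]

theorem continuousOn_gradient (hφ : ContDiffOn ℝ ∞ φ Ω) : ContinuousOn (gradient φ) Ω :=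
  (InnerProductSpace.toDual ℝ _).symm.continuous.comp_continuousOn
    (hφ.continuousOn_fderiv_of_isOpen Ω.isOpen (by simp))

theorem continuousOn_partialDeriv (hφ : ContDiffOn ℝ ∞ φ Ω) :
    ContinuousOn (partialDeriv i φ) Ω :=
  (hφ.continuousOn_fderiv_of_isOpen Ω.isOpen (by simp)).clm_apply continuousOn_const

theorem contDiff_partialDeriv (hφ : ContDiff ℝ ∞ φ) : ContDiff ℝ ∞ (partialDeriv i φ) :=
  (hφ.fderiv_right (by simp)).clm_apply contDiff_const

theorem tsupport_partialDeriv_subset (i : Fin n) (φ : 𝔼 n → ℝ) :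
    tsupport (partialDeriv i φ) ⊆ tsupport φ :=
  tsupport_fderiv_apply_subset ℝ _

theorem hasCompactSupport_partialDeriv (hc : HasCompactSupport φ) (i : Fin n) :
    HasCompactSupport (partialDeriv i φ) :=
  hc.fderiv_apply ℝ _

theorem support_mul_subset_of_tsupport_subset (hs : tsupport φ ⊆ Ω) (u : 𝔼 n → ℝ) :
    Function.support (fun x => φ x * u x) ⊆ Ω :=
  (Function.support_mul_subset_left φ u).trans ((subset_tsupport φ).trans hs)

theorem setIntegral_mul_of_tsupport_subset (hs : tsupport φ ⊆ Ω) (u : 𝔼 n → ℝ) :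
    ∫ x in Ω, φ x * u x = ∫ x, φ x * u x :=
  setIntegral_eq_integral_of_forall_compl_eq_zero fun _ hx =>
    Function.notMem_support.1 fun h => hx (support_mul_subset_of_tsupport_subset hs u h)

theorem integrable_mul_of_tsupport_subset (hu : LocallyIntegrableOn u Ω) (hφ : Continuous φ)
    (hc : HasCompactSupport φ) (hs : tsupport φ ⊆ Ω) : Integrable fun x => φ x * u x :=
  (integrableOn_iff_integrable_of_support_subset
    (support_mul_subset_of_tsupport_subset hs u)).1
    (integrableOn_mul_of_locallyIntegrableOn hu hφ hc hs)

theorem isWeakPartial_partialDeriv (hφ : ContDiffOn ℝ ∞ φ Ω) :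
    IsWeakPartial Ω i φ (partialDeriv i φ) := by
  have h0 : LocallyIntegrableOn φ Ω :=
    hφ.continuousOn.locallyIntegrableOn Ω.isOpen.measurableSet
  have h1 : LocallyIntegrableOn (partialDeriv i φ) Ω :=
    (continuousOn_partialDeriv hφ).locallyIntegrableOn Ω.isOpen.measurableSet
  refine ⟨h0, h1, fun ψ hψ hc hs => ?_⟩
  have hs' := (tsupport_partialDeriv_subset i ψ).trans hs
  rw [setIntegral_mul_of_tsupport_subset hs, setIntegral_mul_of_tsupport_subset hs']
  exact integral_mul_fderiv_eq_neg_fderiv_mul_of_integrable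
    (integrable_mul_of_tsupport_subset h0 (contDiff_partialDeriv hψ).continuous
      (hasCompactSupport_partialDeriv hc i) hs')
    (integrable_mul_of_tsupport_subset h1 hψ.continuous hc hs)
    (integrable_mul_of_tsupport_subset h0 hψ.continuous hc hs)
    (fun x _ => hψ.differentiable (by simp) x)
    (fun x hx => differentiableAt_of_smoothOn hφ (hs hx))

end PartialDerivatives

theorem norm_withLp_prod_le {F G : Type*} [NormedAddCommGroup F] [NormedAddCommGroup G] {r : ℝ≥0∞}
    [Fact (1 ≤ r)] (w : WithLp r (F × G)) : ‖w‖ ≤ ‖w.fst‖ + ‖w.snd‖ := by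
  have h : w = .toLp r (w.fst, 0) + .toLp r (0, w.snd) := by
    rw [← WithLp.toLp_add, Prod.mk_add_mk, add_zero, zero_add]
    rfl
  calc ‖w‖ ≤ ‖WithLp.toLp r (w.fst, (0 : G))‖ + ‖WithLp.toLp r ((0 : F), w.snd)‖ := by
        conv_lhs => rw [h]
        exact norm_add_le _ _
    _ = ‖w.fst‖ + ‖w.snd‖ := by rw [WithLp.norm_toLp_fst, WithLp.norm_toLp_snd]

section SobolevLorentz

variable {n : ℕ} {p : ℝ} {q : ℝ≥0∞} [hq : Fact (1 ≤ q)] {i : Fin n}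
  {Ω Ω' : TopologicalSpace.Opens (𝔼 n)} {φ : 𝔼 n → ℝ}

theorem restrict_le_restrict_of_le (h : Ω' ≤ Ω) :
    volume.restrict (Ω' : Set (𝔼 n)) ≤ volume.restrict (Ω : Set (𝔼 n)) :=
  Measure.restrict_mono_set volume h

theorem LorentzSpace.locallyIntegrableOn (v : LorentzOn p ⊤ Ω ℝ) : LocallyIntegrableOn v.1 Ω :=
  locallyIntegrableOn_of_locallyIntegrable_restrict (LorentzSpace.locallyIntegrable v)

theorem testPairs_le_smoothPairs : testPairs p q Ω ≤ smoothPairs p q Ω := by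
  rintro w ⟨φ, hφ, -, -, h⟩
  exact ⟨φ, hφ.contDiffOn, h⟩

namespace LorentzPair

/-- The pair `(φ, ∇φ)` of classes on `Ω`, for `φ ∈ C^∞(Ω)`. -/
def ofSmooth (hφ : ContDiffOn ℝ ∞ φ Ω) (h : lorentzENorm p q (volume.restrict Ω) φ < ⊤)
    (h' : lorentzENorm p q (volume.restrict Ω) (gradient φ) < ⊤) : LorentzPair p q Ω :=
  .toLp _
    (LorentzSpace.ofFun φ (hφ.continuousOn.aestronglyMeasurable Ω.isOpen.measurableSet) h,
      LorentzSpace.ofFun (gradient φ) ((continuousOn_gradient hφ).aestronglyMeasurable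
        Ω.isOpen.measurableSet) h')

theorem ofSmooth_mem_smoothPairs (hφ : ContDiffOn ℝ ∞ φ Ω)
    (h : lorentzENorm p q (volume.restrict Ω) φ < ⊤)
    (h' : lorentzENorm p q (volume.restrict Ω) (gradient φ) < ⊤) :
    ofSmooth hφ h h' ∈ smoothPairs p q Ω :=
  ⟨φ, hφ, LorentzSpace.coeFn_ofFun _ _ h, LorentzSpace.coeFn_ofFun _ _ h'⟩

/-- The inclusion of pairs induced by `L^{(p,q)}(Ω) → L^{(p,∞)}(Ω')`, `Ω' ⊆ Ω`. -/
def toWeak [Fact (1 < p)] (h : Ω' ≤ Ω) : LorentzPair p q Ω →L[ℝ] LorentzPair p ⊤ Ω' :=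
  (WithLp.prodContinuousLinearEquiv _ ℝ _ _).symm.toContinuousLinearMap ∘L
    ((LorentzSpace.toWeak (restrict_le_restrict_of_le h)).prodMap
      (LorentzSpace.toWeak (restrict_le_restrict_of_le h))) ∘L
    (WithLp.prodContinuousLinearEquiv _ ℝ _ _).toContinuousLinearMap

theorem fst_toWeak [Fact (1 < p)] (h : Ω' ≤ Ω) (w : LorentzPair p q Ω) :
    (toWeak h w).fst = LorentzSpace.toWeak (restrict_le_restrict_of_le h) w.fst :=
  rfl

theorem snd_toWeak [Fact (1 < p)] (h : Ω' ≤ Ω) (w : LorentzPair p q Ω) :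
    (toWeak h w).snd = LorentzSpace.toWeak (restrict_le_restrict_of_le h) w.snd :=
  rfl

theorem toWeak_mem_smoothPairs [Fact (1 < p)] (h : Ω' ≤ Ω) {w : LorentzPair p q Ω}
    (hw : w ∈ smoothPairs p q Ω) : toWeak h w ∈ smoothPairs p ⊤ Ω' := by
  obtain ⟨φ, hφ, h1, h2⟩ := hw
  have hac := Measure.absolutelyContinuous_of_le (restrict_le_restrict_of_le h)
  refine ⟨φ, hφ.mono h, ?_, ?_⟩
  · rw [fst_toWeak]
    exact (LorentzSpace.coeFn_toWeak _ w.fst).trans (hac.ae_eq h1)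
  · rw [snd_toWeak]
    exact (LorentzSpace.coeFn_toWeak _ w.snd).trans (hac.ae_eq h2)

theorem toWeak_mem_sobolevLorentzH [Fact (1 < p)] (h : Ω' ≤ Ω) {w : LorentzPair p q Ω}
    (hw : w ∈ SobolevLorentzH p q Ω) : toWeak h w ∈ SobolevLorentzH p ⊤ Ω' :=
  map_mem_closure (toWeak h).continuous hw fun _ => toWeak_mem_smoothPairs h

/-- The `i`-th component of the second entry of a pair. -/
def component (p : ℝ) (q : ℝ≥0∞) [Fact (1 ≤ q)] (Ω : TopologicalSpace.Opens (𝔼 n)) (i : Fin n) :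
    LorentzPair p q Ω →L[ℝ] LorentzOn p q Ω ℝ :=
  LorentzSpace.compCLM p q _ (EuclideanSpace.proj i) ∘L WithLp.sndL _ ℝ _ _

theorem component_toWeak [Fact (1 < p)] (h : Ω' ≤ Ω) (w : LorentzPair p q Ω) (i : Fin n) :
    component p ⊤ Ω' i (toWeak h w) =
      LorentzSpace.toWeak (restrict_le_restrict_of_le h) (component p q Ω i w) :=
  LorentzSpace.compCLM_toWeak _ (EuclideanSpace.proj i) w.snd

theorem component_ae_eq_partialDeriv {w : LorentzPair p q Ω}
    (h : w.snd.1 =ᵐ[volume.restrict Ω] gradient φ) (i : Fin n) :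
    (component p q Ω i w).1 =ᵐ[volume.restrict Ω] partialDeriv i φ :=
  (LorentzSpace.coeFn_compCLM (EuclideanSpace.proj i) w.snd).trans <| h.mono fun x hx => by
    rw [Function.comp_apply, hx, ← gradient_apply, PiLp.proj_apply]

end LorentzPair

variable [hp : Fact (1 < p)]

theorem funH_subset_funH_top (h : Ω' ≤ Ω) : funH p q Ω ⊆ funH p ⊤ Ω' := by
  rintro u ⟨w, hw, hu⟩
  have hac := Measure.absolutelyContinuous_of_le (restrict_le_restrict_of_le h)
  refine ⟨LorentzPair.toWeak h w, LorentzPair.toWeak_mem_sobolevLorentzH h hw, ?_⟩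
  rw [LorentzPair.fst_toWeak]
  exact (hac.ae_eq hu).trans (LorentzSpace.coeFn_toWeak _ w.fst).symm

theorem isWeakPartial_component {w : LorentzPair p ⊤ Ω} (hw : w ∈ SobolevLorentzH p ⊤ Ω)
    (i : Fin n) : IsWeakPartial Ω i w.fst.1 (LorentzPair.component p ⊤ Ω i w).1 := by
  refine ⟨LorentzSpace.locallyIntegrableOn _, LorentzSpace.locallyIntegrableOn _,
    fun φ hφ hc hs => ?_⟩
  let T : StrongDual ℝ (LorentzPair p ⊤ Ω) :=
    LorentzSpace.weightedIntegral p _ hφ.continuous hc ∘L LorentzPair.component p ⊤ Ω i +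
      LorentzSpace.weightedIntegral p _ (contDiff_partialDeriv hφ).continuous
        (hasCompactSupport_partialDeriv hc i) ∘L WithLp.fstL _ ℝ _ _
  have hT : smoothPairs p ⊤ Ω ≤ T.ker := by
    rintro v ⟨f, hf, h1, h2⟩
    refine (congrArg₂ (· + ·)
      (LorentzSpace.weightedIntegral_apply_of_ae_eq hφ.continuous hc
        (LorentzPair.component_ae_eq_partialDeriv h2 i))
      (LorentzSpace.weightedIntegral_apply_of_ae_eq (contDiff_partialDeriv hφ).continuous
        (hasCompactSupport_partialDeriv hc i) h1)).trans ?_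
    exact add_eq_zero_iff_eq_neg.2 ((isWeakPartial_partialDeriv hf).2.2 φ hφ hc hs)
  exact add_eq_zero_iff_eq_neg.1
    (Submodule.topologicalClosure_minimal _ hT T.isClosed_ker hw)

/-- The inclusion `H^{1,(p,∞)}(Ω) → W^{1,(p,∞)}(Ω)`. -/
def SobolevLorentzH.toW : SobolevLorentzH p ⊤ Ω →L[ℝ] SobolevLorentzW p ⊤ Ω :=
  ((WithLp.prodContinuousLinearEquiv 1 ℝ _ _).symm.toContinuousLinearMap ∘L
    ((WithLp.fstL _ ℝ _ _).prod ((PiLp.continuousLinearEquiv 1 ℝ _).symm.toContinuousLinearMap ∘L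
      ContinuousLinearMap.pi (LorentzPair.component p ⊤ Ω))) ∘L
    (SobolevLorentzH p ⊤ Ω).subtypeL).codRestrict _ fun w => isWeakPartial_component w.2

theorem funH_subset_funW : funH p ⊤ Ω ⊆ funW p ⊤ Ω := fun _ ⟨w, hw, hu⟩ =>
  ⟨SobolevLorentzH.toW ⟨w, hw⟩, (SobolevLorentzH.toW ⟨w, hw⟩).2, hu⟩

end SobolevLorentz

section WeakLimits

variable {ι X Y : Type*} [NormedAddCommGroup X] [NormedSpace ℝ X] [NormedAddCommGroup Y]
  [NormedSpace ℝ Y] {l : Filter ι}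

theorem tendsto_zero_of_mem_closure {f : ι → X →L[ℝ] Y} (hf : ∃ C, ∀ k, ‖f k‖ ≤ C) {S : Set X}
    (h0 : ∀ z ∈ S, Tendsto (fun k => f k z) l (𝓝 0)) {x : X} (hx : x ∈ closure S) :
    Tendsto (fun k => f k x) l (𝓝 0) := by
  have hequi : Equicontinuous ((↑) ∘ f) :=
    ((NormedSpace.equicontinuous_TFAE (𝕜 := ℝ) (𝕜₂ := ℝ) f).out 5 1).1 hf
  exact closure_minimal h0 (hequi.isClosed_setOfPred_tendsto continuous_const) hx

theorem IsReflexiveSpace.exists_forall_tendsto (hX : IsReflexiveSpace X) {s : ι → X} {B : ℝ}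
    (hB : ∀ k, ‖s k‖ ≤ B) (U : Ultrafilter ι) :
    ∃ x, ∀ φ : StrongDual ℝ X, Tendsto (fun k => φ (s k)) U (𝓝 (φ x)) := by
  let J (k : ι) : WeakDual ℝ (StrongDual ℝ X) :=
    StrongDual.toWeakDual (NormedSpace.inclusionInDoubleDual ℝ X (s k))
  have hmem (k : ι) : J k ∈ WeakDual.toStrongDual ⁻¹'
      Metric.closedBall (0 : StrongDual ℝ (StrongDual ℝ X)) B := by
    have h := (NormedSpace.double_dual_bound ℝ X (s k)).trans (hB k)
    exact (dist_zero_right (NormedSpace.inclusionInDoubleDual ℝ X (s k))).trans_le h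
  obtain ⟨Λ, -, hΛ⟩ :=
    (WeakDual.isCompact_closedBall (𝕜 := ℝ) (E := StrongDual ℝ X) 0 B).ultrafilter_le_nhds
      (U.map J) (le_principal_iff.2 (Filter.mem_map.2 (univ_mem' hmem)))
  obtain ⟨x, hx⟩ := hX (WeakDual.toStrongDual Λ)
  refine ⟨x, fun φ => ?_⟩
  have hφ : φ x = Λ φ := congrArg (fun Ψ : StrongDual ℝ (StrongDual ℝ X) => Ψ φ) hx
  rw [hφ]
  exact ((WeakDual.eval_continuous φ).tendsto Λ).comp hΛ

theorem mem_closure_of_convex_of_forall_tendsto [l.NeBot] {S : Set X} (hS : Convex ℝ S)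
    {s : ι → X} (hs : ∀ k, s k ∈ S) {x : X}
    (hx : ∀ φ : StrongDual ℝ X, Tendsto (fun k => φ (s k)) l (𝓝 (φ x))) : x ∈ closure S := by
  by_contra hxS
  obtain ⟨φ, a, ha, hax⟩ := geometric_hahn_banach_closed_point hS.closure isClosed_closure hxS
  exact hax.not_ge (le_of_tendsto (hx φ) (.of_forall fun k => (ha _ (subset_closure (hs k))).le))

theorem not_isReflexiveSpace_of_tendsto {s : ℕ → X} {f : ℕ → StrongDual ℝ X} {B c : ℝ}
    (hB : ∀ N, ‖s N‖ ≤ B) (hf : ∃ C, ∀ k, ‖f k‖ ≤ C) (hc : c ≠ 0)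
    (h1 : ∀ k, Tendsto (fun N => f k (s N)) atTop (𝓝 c))
    (h0 : ∀ N, Tendsto (fun k => f k (s N)) atTop (𝓝 0)) : ¬ IsReflexiveSpace X := by
  intro hX
  obtain ⟨x, hx⟩ := hX.exists_forall_tendsto hB (hyperfilter ℕ)
  have hfx (k : ℕ) : f k x = c :=
    tendsto_nhds_unique (hx (f k)) ((h1 k).mono_left Nat.hyperfilter_le_atTop)
  have hmem : x ∈ closure (Submodule.span ℝ (range s) : Set X) :=
    mem_closure_of_convex_of_forall_tendsto (Submodule.span ℝ (range s)).convex
      (fun N => Submodule.subset_span (mem_range_self N)) hx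
  have hspan : ∀ z ∈ Submodule.span ℝ (range s), Tendsto (fun k => f k z) atTop (𝓝 0) := by
    intro z hz
    induction hz using Submodule.span_induction with
    | mem z hz =>
      obtain ⟨N, rfl⟩ := hz
      exact h0 N
    | zero => simp only [map_zero, tendsto_const_nhds]
    | add a b _ _ ha hb => simpa only [map_add, add_zero] using ha.add hb
    | smul r a _ ha => simpa only [map_smul, smul_zero] using ha.const_smul r
  refine hc (tendsto_nhds_unique ?_ (tendsto_zero_of_mem_closure hf hspan hmem))
  simp only [hfx, tendsto_const_nhds]

end WeakLimits

section Annulus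

variable {E : Type*} [PseudoMetricSpace E] {y : E} {r : ℝ}

/-- The closed annulus of centre `y`, inner radius `r` and outer radius `3r`. -/
def annulus (y : E) (r : ℝ) : Set E :=
  {x | r ≤ dist x y ∧ dist x y ≤ 3 * r}

theorem isClosed_annulus : IsClosed (annulus y r) :=
  (isClosed_le continuous_const (continuous_id.dist continuous_const)).inter
    (isClosed_le (continuous_id.dist continuous_const) continuous_const)

theorem annulus_subset_closedBall : annulus y r ⊆ Metric.closedBall y (3 * r) := fun _ hx => hx.2

theorem notMem_annulus_self (hr : 0 < r) : y ∉ annulus y r := fun h =>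
  hr.not_ge (h.1.trans_eq (dist_self y))

end Annulus

section Dilation

variable {E F : Type*} [NormedAddCommGroup E] [NormedSpace ℝ E] {y : E} {r : ℝ}

/-- The rescaled function `x ↦ h ((x - y) / r)`. -/
def dilate (y : E) (r : ℝ) (h : E → F) (x : E) : F :=
  h (r⁻¹ • (x - y))

theorem inv_smul_sub_mem_annulus_zero_one (hr : 0 < r) {x : E} :
    r⁻¹ • (x - y) ∈ annulus (0 : E) 1 ↔ x ∈ annulus y r := by
  simp only [annulus, mem_ofPred_eq, dist_zero_right, norm_smul, norm_inv,
    Real.norm_of_nonneg hr.le, ← dist_eq_norm, inv_mul_eq_div, le_div_iff₀ hr, div_le_iff₀ hr,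
    one_mul, mul_one]

theorem contDiff_dilate [NormedAddCommGroup F] [NormedSpace ℝ F] {h : E → F}
    (hh : ContDiff ℝ ∞ h) : ContDiff ℝ ∞ (dilate y r h) :=
  hh.comp ((contDiff_id.sub contDiff_const).const_smul r⁻¹)

theorem fderiv_dilate [NormedAddCommGroup F] [NormedSpace ℝ F] (h : E → F) :
    fderiv ℝ (dilate y r h) = r⁻¹ • dilate y r (fderiv ℝ h) := by
  ext1 x
  exact (fderiv_comp_sub (f := fun z => h (r⁻¹ • z)) y).trans (fderiv_comp_smul r⁻¹)

theorem tsupport_dilate_subset [Zero F] {h : E → F} (hr : 0 < r)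
    (hh : tsupport h ⊆ annulus 0 1) : tsupport (dilate y r h) ⊆ annulus y r :=
  closure_minimal (fun _ hx => (inv_smul_sub_mem_annulus_zero_one hr).1
    (hh (subset_tsupport h hx))) isClosed_annulus

theorem integral_dilate [FiniteDimensional ℝ E] [MeasurableSpace E] [BorelSpace E]
    (μ : Measure E) [μ.IsAddHaarMeasure] [NormedAddCommGroup F] [NormedSpace ℝ F]
    (hr : 0 ≤ r) (h : E → F) :
    ∫ x, dilate y r h x ∂μ = r ^ Module.finrank ℝ E • ∫ x, h x ∂μ := by
  unfold dilate
  rw [integral_sub_right_eq_self (fun x => h (r⁻¹ • x)) y, Measure.integral_comp_inv_smul,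
    abs_of_nonneg (by positivity)]

theorem norm_rpow_smul_dilate_le [NormedAddCommGroup F] [NormedSpace ℝ F] {h : E → F} {M s : ℝ}
    (hM : ∀ z, ‖h z‖ ≤ M) (hh : tsupport h ⊆ annulus 0 1) (hr : 0 < r) (hs : 0 ≤ s) (x : E) :
    ‖r ^ (-s) • dilate y r h x‖ ≤ M * 3 ^ s * dist x y ^ (-s) := by
  have hM0 : 0 ≤ M := (norm_nonneg _).trans (hM 0)
  by_cases hx : x ∈ annulus y r
  · have hd : 0 < dist x y := hr.trans_le hx.1
    have hrd : r ^ (-s) ≤ 3 ^ s * dist x y ^ (-s) := by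
      rw [Real.rpow_neg hr.le, Real.rpow_neg hd.le, ← div_eq_mul_inv, inv_eq_one_div,
        div_le_div_iff₀ (by positivity) (by positivity), one_mul,
        ← Real.mul_rpow (by norm_num) hr.le]
      exact Real.rpow_le_rpow hd.le hx.2 hs
    rw [norm_smul, Real.norm_of_nonneg (by positivity), mul_comm, mul_assoc]
    exact mul_le_mul (hM _) hrd (by positivity) hM0
  · rw [image_eq_zero_of_notMem_tsupport fun h => hx (tsupport_dilate_subset hr hh h), smul_zero,
      norm_zero]
    positivity

end Dilation

section AnnulusBump

variable {n : ℕ} (i : Fin n)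

/-- A bump function centred at `2e_i` and supported in the annulus `1 ≤ |z| ≤ 3`. -/
def annulusBump : ContDiffBump (EuclideanSpace.single i (2 : ℝ)) where
  rIn := 1 / 2
  rOut := 1
  rIn_pos := by norm_num
  rIn_lt_rOut := by norm_num

/-- The squared `L²` norm of `∂_i η`, where `η` is `annulusBump i`. -/
def bumpEnergy : ℝ :=
  ∫ z, partialDeriv i (annulusBump i) z ^ 2

theorem tsupport_annulusBump_subset : tsupport (annulusBump i) ⊆ annulus 0 1 := by
  rw [(annulusBump i).tsupport_eq]
  intro z hz
  have hz : ‖z - EuclideanSpace.single i (2 : ℝ)‖ ≤ 1 := mem_closedBall_iff_norm.1 hz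
  have hc : ‖EuclideanSpace.single i (2 : ℝ)‖ = 2 := by
    rw [PiLp.norm_single, Real.norm_ofNat]
  have habs := abs_le.1 ((abs_norm_sub_norm_le z (EuclideanSpace.single i (2 : ℝ))).trans hz)
  rw [hc] at habs
  constructor <;> rw [dist_zero_right] <;> linarith

theorem contDiff_annulusBump : ContDiff ℝ ∞ (annulusBump i) := (annulusBump i).contDiff

theorem contDiff_partialDeriv_annulusBump : ContDiff ℝ ∞ (partialDeriv i (annulusBump i)) :=
  contDiff_partialDeriv (contDiff_annulusBump i)

theorem hasCompactSupport_partialDeriv_annulusBump :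
    HasCompactSupport (partialDeriv i (annulusBump i)) :=
  hasCompactSupport_partialDeriv (annulusBump i).hasCompactSupport i

theorem tsupport_partialDeriv_annulusBump_subset :
    tsupport (partialDeriv i (annulusBump i)) ⊆ annulus 0 1 :=
  (tsupport_partialDeriv_subset i _).trans (tsupport_annulusBump_subset i)

theorem annulusBump_center : annulusBump i (EuclideanSpace.single i 2) = 1 :=
  (annulusBump i).one_of_mem_closedBall (Metric.mem_closedBall_self (annulusBump i).rIn_pos.le)

theorem annulusBump_zero : annulusBump i 0 = 0 :=
  image_eq_zero_of_notMem_tsupport fun h =>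
    notMem_annulus_self one_pos (tsupport_annulusBump_subset i h)

theorem exists_partialDeriv_annulusBump_ne_zero :
    ∃ z, partialDeriv i (annulusBump i) z ≠ 0 := by
  by_contra! h0
  have hderiv (t : ℝ) :
      HasDerivAt (fun t => annulusBump i (t • EuclideanSpace.single i 1)) 0 t := by
    have h := ((contDiff_annulusBump i).differentiable (by simp) _).hasFDerivAt.comp_hasDerivAt t
      ((hasDerivAt_id t).smul_const (EuclideanSpace.single i (1 : ℝ)))
    rw [one_smul] at h
    exact (h0 _) ▸ h
  have hconst := is_const_of_deriv_eq_zero (fun t => (hderiv t).differentiableAt)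
    (fun t => (hderiv t).deriv) 2 0
  have hcenter : (2 : ℝ) • EuclideanSpace.single i (1 : ℝ) = EuclideanSpace.single i 2 := by
    ext j
    by_cases hj : j = i <;> simp [hj]
  rw [zero_smul, annulusBump_zero, hcenter, annulusBump_center] at hconst
  exact one_ne_zero hconst

theorem bumpEnergy_pos : 0 < bumpEnergy i := by
  obtain ⟨z, hz⟩ := exists_partialDeriv_annulusBump_ne_zero i
  exact ((contDiff_partialDeriv_annulusBump i).continuous.pow 2
    ).integral_pos_of_hasCompactSupport_nonneg_nonzero
    ((hasCompactSupport_partialDeriv_annulusBump i).comp_left (zero_pow two_ne_zero))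
    (fun z => sq_nonneg _) (pow_ne_zero 2 hz)

end AnnulusBump

section Concentration

variable {n : ℕ} {p r : ℝ} {i : Fin n} {y : 𝔼 n}

/-- The bump `r^{1 - n/p} η((x - y)/r)`, whose gradient has a weak `L^p` norm independent
of `r`. -/
def concBump (p : ℝ) (i : Fin n) (y : 𝔼 n) (r : ℝ) : 𝔼 n → ℝ :=
  r ^ (1 - n / p : ℝ) • dilate y r (annulusBump i)

/-- The weight `r^{n/p - n} (∂_i η)((x - y)/r)` against which `∂_i` of a function is tested. The
power of `r` makes the functionals with these weights uniformly bounded on `L^{(p,∞)}`. -/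
def concWeight (p : ℝ) (i : Fin n) (y : 𝔼 n) (r : ℝ) : 𝔼 n → ℝ :=
  r ^ (n / p - n : ℝ) • dilate y r (partialDeriv i (annulusBump i))

theorem contDiff_concBump : ContDiff ℝ ∞ (concBump p i y r) :=
  (contDiff_dilate (contDiff_annulusBump i)).const_smul (r ^ (1 - n / p : ℝ))

theorem contDiff_concWeight : ContDiff ℝ ∞ (concWeight p i y r) :=
  (contDiff_dilate (contDiff_partialDeriv_annulusBump i)).const_smul (r ^ (n / p - n : ℝ))

theorem tsupport_concBump_subset (hr : 0 < r) : tsupport (concBump p i y r) ⊆ annulus y r :=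
  (tsupport_smul_subset_right (fun _ => r ^ (1 - n / p : ℝ)) _).trans
    (tsupport_dilate_subset hr (tsupport_annulusBump_subset i))

theorem tsupport_concWeight_subset (hr : 0 < r) : tsupport (concWeight p i y r) ⊆ annulus y r :=
  (tsupport_smul_subset_right (fun _ => r ^ (n / p - n : ℝ)) _).trans
    (tsupport_dilate_subset hr (tsupport_partialDeriv_annulusBump_subset i))

theorem hasCompactSupport_concWeight (hr : 0 < r) : HasCompactSupport (concWeight p i y r) :=
  (isCompact_closedBall y (3 * r)).of_isClosed_subset (isClosed_tsupport _)
    ((tsupport_concWeight_subset hr).trans annulus_subset_closedBall)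

theorem fderiv_concBump (hr : 0 < r) (x : 𝔼 n) :
    fderiv ℝ (concBump p i y r) x =
      r ^ (-(n / p) : ℝ) • dilate y r (fderiv ℝ (annulusBump i)) x := by
  have hpow : r ^ (-(n / p) : ℝ) = r ^ (1 - n / p : ℝ) * r⁻¹ := by
    rw [← Real.rpow_neg_one, ← Real.rpow_add hr]
    congr 1
    ring
  rw [concBump, fderiv_const_smul_field, fderiv_dilate, hpow, mul_smul]
  rfl

theorem integral_concWeight_mul_partialDeriv_concBump (hr : 0 < r) :
    ∫ x, concWeight p i y r x * partialDeriv i (concBump p i y r) x = bumpEnergy i := by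
  have hpow : r ^ (n / p - n : ℝ) * r ^ (-(n / p) : ℝ) = (r ^ n)⁻¹ := by
    rw [← Real.rpow_add hr, ← Real.rpow_natCast, ← Real.rpow_neg hr.le]
    congr 1
    ring
  have hint (x : 𝔼 n) : concWeight p i y r x * partialDeriv i (concBump p i y r) x =
      (r ^ n)⁻¹ * dilate y r (fun z => partialDeriv i (annulusBump i) z ^ 2) x := by
    rw [partialDeriv, fderiv_concBump hr, ← hpow]
    simp only [concWeight, Pi.smul_apply, smul_eq_mul, dilate, _root_.smul_apply]
    ring
  simp only [hint]
  rw [integral_const_mul, integral_dilate _ hr.le, finrank_euclideanSpace_fin, smul_eq_mul,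
    inv_mul_cancel_left₀ (by positivity), bumpEnergy]

theorem integral_norm_concWeight (hr : 0 < r) :
    ∫ x, ‖concWeight p i y r x‖ =
      r ^ (n / p : ℝ) * ∫ z, ‖partialDeriv i (annulusBump i) z‖ := by
  have hpow : r ^ (n / p : ℝ) = r ^ (n / p - n : ℝ) * r ^ n := by
    rw [← Real.rpow_add_natCast hr.ne', sub_add_cancel]
  have hint (x : 𝔼 n) : ‖concWeight p i y r x‖ =
      r ^ (n / p - n : ℝ) * dilate y r (fun z => ‖partialDeriv i (annulusBump i) z‖) x := by
    rw [concWeight, Pi.smul_apply, norm_smul, Real.norm_of_nonneg (by positivity), dilate, dilate]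
  simp only [hint]
  rw [integral_const_mul, integral_dilate _ hr.le, finrank_euclideanSpace_fin, smul_eq_mul, hpow,
    mul_assoc]

theorem exists_norm_concBump_le (hp : 0 < p) (i : Fin n) (y : 𝔼 n) {ρ : ℝ} (hρ : 0 < ρ) :
    ∃ M, 0 ≤ M ∧ ∀ r, 0 < r → r ≤ ρ → ∀ x,
      ‖concBump p i y r x‖ ≤ M * dist x y ^ (-(n / p) : ℝ) ∧
      ‖fderiv ℝ (concBump p i y r) x‖ ≤ M * dist x y ^ (-(n / p) : ℝ) := by
  obtain ⟨M₀, hM₀⟩ := (contDiff_annulusBump i).continuous.bounded_above_of_compact_support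
    (annulusBump i).hasCompactSupport
  obtain ⟨M₁, hM₁⟩ := ((contDiff_annulusBump i).continuous_fderiv (by simp)
    ).bounded_above_of_compact_support ((annulusBump i).hasCompactSupport.fderiv ℝ)
  have hM₀' : 0 ≤ M₀ := (norm_nonneg _).trans (hM₀ 0)
  have hM₁' : 0 ≤ M₁ := (norm_nonneg _).trans (hM₁ 0)
  have hs : (0 : ℝ) ≤ n / p := by positivity
  refine ⟨(ρ * M₀ + M₁) * 3 ^ (n / p : ℝ), by positivity, fun r hr hrρ x => ⟨?_, ?_⟩⟩
  · have hx : concBump p i y r x = r • r ^ (-(n / p) : ℝ) • dilate y r (annulusBump i) x := by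
      rw [concBump, Pi.smul_apply, sub_eq_add_neg, Real.rpow_add hr, Real.rpow_one, mul_smul]
    rw [hx, norm_smul, Real.norm_of_nonneg hr.le]
    calc
      _ ≤ ρ * (M₀ * 3 ^ (n / p : ℝ) * dist x y ^ (-(n / p) : ℝ)) := by
        gcongr
        exact norm_rpow_smul_dilate_le hM₀ (tsupport_annulusBump_subset i) hr hs x
      _ = ρ * M₀ * 3 ^ (n / p : ℝ) * dist x y ^ (-(n / p) : ℝ) := by ring
      _ ≤ _ := by
        gcongr
        exact le_add_of_nonneg_right hM₁'
  · rw [fderiv_concBump hr]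
    refine (norm_rpow_smul_dilate_le hM₁
      ((tsupport_fderiv_subset ℝ).trans (tsupport_annulusBump_subset i)) hr hs x).trans ?_
    gcongr
    exact le_add_of_nonneg_left (by positivity)

end Concentration

section ConcFunctional

variable {n : ℕ} {p r : ℝ} {i : Fin n} {y : 𝔼 n}

theorem exists_norm_concWeight_le (p : ℝ) (i : Fin n) (y : 𝔼 n) :
    ∃ M, 0 ≤ M ∧ ∀ r, 0 < r → ∀ x, ‖concWeight p i y r x‖ ≤ M * r ^ (n / p - n : ℝ) := by
  obtain ⟨M, hM⟩ :=
    (contDiff_partialDeriv_annulusBump i).continuous.bounded_above_of_compact_support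
      (hasCompactSupport_partialDeriv_annulusBump i)
  refine ⟨M, (norm_nonneg _).trans (hM 0), fun r hr x => ?_⟩
  rw [concWeight, Pi.smul_apply, norm_smul, Real.norm_of_nonneg (by positivity), mul_comm]
  gcongr
  exact hM _

/-- The volume of a ball of radius `3`, the outer radius of `annulus 0 1`. -/
def outerVolume (n : ℕ) : ℝ :=
  volume.real (Metric.closedBall (0 : 𝔼 n) 3)

theorem outerVolume_pos (n : ℕ) : 0 < outerVolume n :=
  ENNReal.toReal_pos (Metric.measure_closedBall_pos _ _ (by norm_num)).ne'
    measure_closedBall_lt_top.ne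

theorem volume_annulus_le (hr : 0 ≤ r) :
    volume (annulus y r) ≤ ENNReal.ofReal (r ^ n * outerVolume n) := by
  refine (measure_mono annulus_subset_closedBall).trans_eq ?_
  rw [mul_comm 3 r, Measure.addHaar_closedBall_mul _ _ hr (by norm_num),
    finrank_euclideanSpace_fin, ENNReal.ofReal_mul (by positivity), outerVolume,
    ofReal_measureReal measure_closedBall_lt_top.ne]

theorem restrict_support_concWeight_le (hr : 0 < r) (S : Set (𝔼 n)) :
    volume.restrict S (Function.support (concWeight p i y r)) ≤
      ENNReal.ofReal (r ^ n * outerVolume n) :=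
  (Measure.restrict_apply_le _ _).trans <| (measure_mono <|
    (subset_tsupport _).trans (tsupport_concWeight_subset hr)).trans (volume_annulus_le hr.le)

theorem rpow_mul_volume_rpow (hr : 0 < r) (M : ℝ) :
    M * r ^ (n / p - n : ℝ) * (r ^ n * outerVolume n) ^ (1 - 1 / p) =
      M * outerVolume n ^ (1 - 1 / p) := by
  rw [Real.mul_rpow (by positivity) (outerVolume_pos n).le, ← Real.rpow_natCast,
    ← Real.rpow_mul hr.le, mul_assoc, ← mul_assoc (r ^ _), ← Real.rpow_add hr,
    show n / p - n + n * (1 - 1 / p) = 0 by ring, Real.rpow_zero, one_mul]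

theorem exists_enorm_setIntegral_concWeight_mul_le (p : ℝ) (i : Fin n) (y : 𝔼 n) :
    ∃ C, ∀ r, 0 < r → ∀ (S : Set (𝔼 n)) (f : 𝔼 n → ℝ), AEMeasurable f (volume.restrict S) →
      ‖∫ x in S, concWeight p i y r x * f x‖ₑ ≤
        ENNReal.ofReal C * lorentzProfile p (volume.restrict S) f (r ^ n * outerVolume n) := by
  obtain ⟨M, hM, h⟩ := exists_norm_concWeight_le p i y
  refine ⟨M * outerVolume n ^ (1 - 1 / p), fun r hr S f hf => ?_⟩
  have ht : 0 < r ^ n * outerVolume n := mul_pos (pow_pos hr n) (outerVolume_pos n)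
  refine (enorm_integral_le_lintegral_enorm _).trans <|
    (lintegral_enorm_mul_le_lorentzProfile (p := p) hf ht (h r hr)
      (restrict_support_concWeight_le hr S)).trans_eq ?_
  rw [ENNReal.ofReal_rpow_of_pos ht, ← ENNReal.ofReal_mul (by positivity),
    rpow_mul_volume_rpow hr]

variable {Ω : TopologicalSpace.Opens (𝔼 n)}

/-- The functional `v ↦ ∫ w v` on `L^{(p,∞)}(Ω)`, where `w` is `concWeight p i y r`. -/
def concFunctional (p : ℝ) (i : Fin n) (y : 𝔼 n) (hr : 0 < r)
    (Ω : TopologicalSpace.Opens (𝔼 n)) : StrongDual ℝ (LorentzOn p ⊤ Ω ℝ) :=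
  LorentzSpace.weightedIntegral p (volume.restrict Ω) (contDiff_concWeight (r := r)).continuous
    (hasCompactSupport_concWeight (p := p) (i := i) (y := y) hr)

theorem concFunctional_apply_of_ae_eq (hr : 0 < r) {v : LorentzOn p ⊤ Ω ℝ} {f : 𝔼 n → ℝ}
    (h : v.1 =ᵐ[volume.restrict Ω] f) :
    concFunctional p i y hr Ω v = ∫ x in Ω, concWeight p i y r x * f x :=
  LorentzSpace.weightedIntegral_apply_of_ae_eq _ _ h

theorem exists_norm_concFunctional_le (p : ℝ) (i : Fin n) (y : 𝔼 n)
    (Ω : TopologicalSpace.Opens (𝔼 n)) :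
    ∃ C, ∀ r (hr : 0 < r), ‖concFunctional p i y hr Ω‖ ≤ C := by
  obtain ⟨M, hM, h⟩ := exists_norm_concWeight_le p i y
  refine ⟨M * outerVolume n ^ (1 - 1 / p), fun r hr => ?_⟩
  rw [← rpow_mul_volume_rpow hr]
  exact LorentzSpace.norm_weightedIntegral_le _ _ (by positivity)
    (mul_pos (pow_pos hr n) (outerVolume_pos n)) (h r hr)
    (restrict_support_concWeight_le hr (Ω : Set (𝔼 n)))

end ConcFunctional

section Series

variable {n : ℕ} {p ρ : ℝ} {i : Fin n} {y : 𝔼 n}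

/-- The radii `ρ / 4^k`, whose annuli are disjoint. -/
def radius (ρ : ℝ) (k : ℕ) : ℝ :=
  ρ / 4 ^ k

theorem radius_pos (hρ : 0 < ρ) (k : ℕ) : 0 < radius ρ k := by
  unfold radius
  positivity

theorem radius_antitone (hρ : 0 ≤ ρ) : Antitone (radius ρ) := fun j k hjk => by
  unfold radius
  gcongr
  norm_num

theorem radius_le (hρ : 0 ≤ ρ) (k : ℕ) : radius ρ k ≤ ρ :=
  div_le_self hρ (one_le_pow₀ (by norm_num))

theorem tendsto_radius (ρ : ℝ) : Tendsto (radius ρ) atTop (𝓝 0) :=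
  tendsto_const_nhds.div_atTop (tendsto_pow_atTop_atTop_of_one_lt (by norm_num))

theorem tendsto_radius_nhdsGT (hρ : 0 < ρ) : Tendsto (radius ρ) atTop (𝓝[>] 0) :=
  tendsto_nhdsWithin_iff.2 ⟨tendsto_radius ρ, .of_forall fun k => radius_pos hρ k⟩

theorem eventually_three_mul_radius_lt (ρ : ℝ) {d : ℝ} (hd : 0 < d) :
    ∀ᶠ N in atTop, 3 * radius ρ N < d := by
  have h := (tendsto_radius ρ).const_mul 3
  rw [mul_zero] at h
  exact h.eventually (gt_mem_nhds hd)

theorem eq_of_mem_annulus (hρ : 0 < ρ) {j k : ℕ} {x : 𝔼 n}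
    (hj : x ∈ annulus y (radius ρ j)) (hk : x ∈ annulus y (radius ρ k)) : j = k := by
  have not_lt_of_mem : ∀ {j k : ℕ}, x ∈ annulus y (radius ρ j) → x ∈ annulus y (radius ρ k) →
      ¬ j < k := fun {j k} hj hk hjk => by
    have h1 : radius ρ k ≤ radius ρ (j + 1) := radius_antitone hρ.le hjk
    have h2 : radius ρ (j + 1) = radius ρ j / 4 := by
      rw [radius, radius, pow_succ, div_div]
    linarith [hj.1, hk.2, radius_pos hρ j]
  exact le_antisymm (not_lt.1 (not_lt_of_mem hk hj)) (not_lt.1 (not_lt_of_mem hj hk))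

theorem annulus_radius_subset (hρ : 0 ≤ ρ) {S : Set (𝔼 n)}
    (hS : Metric.closedBall y (3 * ρ) ⊆ S) (k : ℕ) : annulus y (radius ρ k) ⊆ S :=
  (annulus_subset_closedBall.trans (Metric.closedBall_subset_closedBall
    (mul_le_mul_of_nonneg_left (radius_le hρ k) (by norm_num)))).trans hS

theorem norm_sum_le_of_subsingleton_support {ι V : Type*} [SeminormedAddCommGroup V] {a : ι → V}
    {B : ℝ} (hB : 0 ≤ B) (ha : ∀ k, ‖a k‖ ≤ B) (h : (Function.support a).Subsingleton)
    (s : Finset ι) : ‖∑ k ∈ s, a k‖ ≤ B := by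
  by_cases h0 : ∃ k ∈ s, a k ≠ 0
  · obtain ⟨k, hk, hak⟩ := h0
    rw [Finset.sum_eq_single_of_mem k hk fun j _ hj => by_contra fun haj => hj (h haj hak)]
    exact ha k
  · push Not at h0
    rwa [Finset.sum_eq_zero h0, norm_zero]

/-- The partial sums of the series of bumps concentrating at `y`. -/
def bumpSum (p : ℝ) (i : Fin n) (y : 𝔼 n) (ρ : ℝ) (N : ℕ) (x : 𝔼 n) : ℝ :=
  ∑ k ∈ Finset.range N, concBump p i y (radius ρ k) x

/-- The sum of the series of bumps concentrating at `y`. At each point at most one term is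
nonzero. -/
def bumpSeries (p : ℝ) (i : Fin n) (y : 𝔼 n) (ρ : ℝ) (x : 𝔼 n) : ℝ :=
  ∑' k, concBump p i y (radius ρ k) x

theorem mem_annulus_of_concBump_ne_zero (hρ : 0 < ρ) {k : ℕ} {x : 𝔼 n}
    (hx : concBump p i y (radius ρ k) x ≠ 0) : x ∈ annulus y (radius ρ k) :=
  tsupport_concBump_subset (radius_pos hρ k) (subset_tsupport _ hx)

theorem mem_annulus_of_fderiv_concBump_ne_zero (hρ : 0 < ρ) {k : ℕ} {x : 𝔼 n}
    (hx : fderiv ℝ (concBump p i y (radius ρ k)) x ≠ 0) : x ∈ annulus y (radius ρ k) :=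
  tsupport_concBump_subset (radius_pos hρ k) (tsupport_fderiv_subset ℝ (subset_tsupport _ hx))

theorem contDiff_bumpSum (N : ℕ) : ContDiff ℝ ∞ (bumpSum p i y ρ N) :=
  ContDiff.sum fun _ _ => contDiff_concBump

theorem fderiv_bumpSum (N : ℕ) (x : 𝔼 n) :
    fderiv ℝ (bumpSum p i y ρ N) x =
      ∑ k ∈ Finset.range N, fderiv ℝ (concBump p i y (radius ρ k)) x :=
  fderiv_fun_sum fun _ _ => contDiff_concBump.differentiable (by simp) x

theorem tsupport_bumpSum_subset (hρ : 0 < ρ) (N : ℕ) :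
    tsupport (bumpSum p i y ρ N) ⊆ Metric.closedBall y (3 * ρ) := by
  refine closure_minimal (fun x hx => ?_) Metric.isClosed_closedBall
  obtain ⟨k, -, hk⟩ := Finset.exists_ne_zero_of_sum_ne_zero hx
  exact annulus_radius_subset hρ.le subset_rfl k (mem_annulus_of_concBump_ne_zero hρ hk)

theorem hasCompactSupport_bumpSum (hρ : 0 < ρ) (N : ℕ) :
    HasCompactSupport (bumpSum p i y ρ N) :=
  (isCompact_closedBall y (3 * ρ)).of_isClosed_subset (isClosed_tsupport _)
    (tsupport_bumpSum_subset hρ N)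

theorem exists_norm_bumpSum_le (hp : 0 < p) (i : Fin n) (y : 𝔼 n) (hρ : 0 < ρ) :
    ∃ M, 0 ≤ M ∧ ∀ N x, ‖bumpSum p i y ρ N x‖ ≤ M * dist x y ^ (-(n / p) : ℝ) ∧
      ‖fderiv ℝ (bumpSum p i y ρ N) x‖ ≤ M * dist x y ^ (-(n / p) : ℝ) := by
  obtain ⟨M, hM, h⟩ := exists_norm_concBump_le hp i y hρ
  refine ⟨M, hM, fun N x => ⟨?_, ?_⟩⟩
  · exact norm_sum_le_of_subsingleton_support (by positivity)
      (fun k => (h _ (radius_pos hρ k) (radius_le hρ.le k) x).1) (fun j hj k hk =>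
      eq_of_mem_annulus hρ (mem_annulus_of_concBump_ne_zero hρ hj)
        (mem_annulus_of_concBump_ne_zero hρ hk)) _
  · rw [fderiv_bumpSum]
    exact norm_sum_le_of_subsingleton_support (by positivity)
      (fun k => (h _ (radius_pos hρ k) (radius_le hρ.le k) x).2) (fun j hj k hk =>
      eq_of_mem_annulus hρ (mem_annulus_of_fderiv_concBump_ne_zero hρ hj)
        (mem_annulus_of_fderiv_concBump_ne_zero hρ hk)) _

theorem bumpSeries_eq_concBump (hρ : 0 < ρ) {k : ℕ} {x : 𝔼 n}
    (hx : x ∈ annulus y (radius ρ k)) :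
    bumpSeries p i y ρ x = concBump p i y (radius ρ k) x :=
  tsum_eq_single k fun _ hj => by_contra fun hne =>
    hj (eq_of_mem_annulus hρ (mem_annulus_of_concBump_ne_zero hρ hne) hx)

theorem bumpSeries_eq_bumpSum (hρ : 0 < ρ) {N : ℕ} {x : 𝔼 n}
    (hx : 3 * radius ρ N < dist x y) : bumpSeries p i y ρ x = bumpSum p i y ρ N x := by
  refine tsum_eq_sum fun k hk => by_contra fun hne => ?_
  have h1 := (mem_annulus_of_concBump_ne_zero hρ hne).2
  have h2 := radius_antitone hρ.le (not_lt.1 fun h => hk (Finset.mem_range.2 h))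
  linarith

theorem bumpSeries_eventuallyEq (hρ : 0 < ρ) {N : ℕ} {x : 𝔼 n}
    (hx : 3 * radius ρ N < dist x y) : bumpSeries p i y ρ =ᶠ[𝓝 x] bumpSum p i y ρ N := by
  have hnhds : {z | 3 * radius ρ N < dist z y} ∈ 𝓝 x :=
    (isOpen_lt continuous_const (continuous_id.dist continuous_const)).mem_nhds hx
  filter_upwards [hnhds] with z hz
  exact bumpSeries_eq_bumpSum hρ hz

theorem contDiffOn_bumpSeries (hρ : 0 < ρ) {S : Set (𝔼 n)} (hy : y ∉ S) :
    ContDiffOn ℝ ∞ (bumpSeries p i y ρ) S := fun x hx => by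
  obtain ⟨N, hN⟩ := (eventually_three_mul_radius_lt ρ
    (dist_pos.2 (ne_of_mem_of_not_mem hx hy))).exists
  exact ((contDiff_bumpSum N).contDiffAt.congr_of_eventuallyEq
    (bumpSeries_eventuallyEq hρ hN)).contDiffWithinAt

theorem exists_norm_bumpSeries_le (hp : 0 < p) (i : Fin n) (y : 𝔼 n) (hρ : 0 < ρ) :
    ∃ M, 0 ≤ M ∧ ∀ x, x ≠ y → ‖bumpSeries p i y ρ x‖ ≤ M * dist x y ^ (-(n / p) : ℝ) ∧
      ‖fderiv ℝ (bumpSeries p i y ρ) x‖ ≤ M * dist x y ^ (-(n / p) : ℝ) := by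
  obtain ⟨M, hM, h⟩ := exists_norm_bumpSum_le hp i y hρ
  refine ⟨M, hM, fun x hx => ?_⟩
  obtain ⟨N, hN⟩ := (eventually_three_mul_radius_lt ρ (dist_pos.2 hx)).exists
  rw [bumpSeries_eq_bumpSum hρ hN, (bumpSeries_eventuallyEq hρ hN).fderiv_eq]
  exact h N x

end Series

section DominatedWeakPartial

variable {n : ℕ} {Ω : TopologicalSpace.Opens (𝔼 n)} {a : ℕ → 𝔼 n → ℝ} {b G : 𝔼 n → ℝ}

theorem locallyIntegrableOn_of_tendsto (ha : ∀ N, LocallyIntegrableOn (a N) Ω)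
    (hG : LocallyIntegrableOn G Ω) (haG : ∀ N, ∀ᵐ x ∂volume.restrict Ω, ‖a N x‖ ≤ G x)
    (hab : ∀ᵐ x ∂volume.restrict Ω, Tendsto (a · x) atTop (𝓝 (b x))) :
    LocallyIntegrableOn b Ω := fun x hx => by
  obtain ⟨s, hs, hGs⟩ := hG x hx
  have hac : (volume.restrict (s ∩ Ω)).AbsolutelyContinuous (volume.restrict Ω) :=
    Measure.absolutelyContinuous_of_le (Measure.restrict_mono inter_subset_right le_rfl)
  have hb : AEStronglyMeasurable b (volume.restrict Ω) :=
    aestronglyMeasurable_of_tendsto_ae atTop (fun N => (ha N).aestronglyMeasurable) hab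
  refine ⟨s ∩ Ω, inter_mem hs self_mem_nhdsWithin,
    (hGs.mono_set inter_subset_left).mono' (hb.mono_ac hac) (hac.ae_le ?_)⟩
  filter_upwards [ae_all_iff.2 haG, hab] with z hz hzb
  exact le_of_tendsto hzb.norm (.of_forall hz)

theorem tendsto_setIntegral_mul_of_dominated (ha : ∀ N, LocallyIntegrableOn (a N) Ω)
    (hG : LocallyIntegrableOn G Ω) (haG : ∀ N, ∀ᵐ x ∂volume.restrict Ω, ‖a N x‖ ≤ G x)
    (hab : ∀ᵐ x ∂volume.restrict Ω, Tendsto (a · x) atTop (𝓝 (b x))) {θ : 𝔼 n → ℝ}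
    (hθ : Continuous θ) (hc : HasCompactSupport θ) (hs : tsupport θ ⊆ Ω) :
    Tendsto (fun N => ∫ x in Ω, θ x * a N x) atTop (𝓝 (∫ x in Ω, θ x * b x)) := by
  refine tendsto_integral_of_dominated_convergence (fun x => |θ x| * G x)
    (fun N => hθ.aestronglyMeasurable.mul (ha N).aestronglyMeasurable) ?_ (fun N => ?_) ?_
  · exact integrableOn_mul_of_locallyIntegrableOn hG hθ.abs hc.norm
      ((tsupport_comp_subset abs_zero θ).trans hs)
  · filter_upwards [haG N] with x hx
    rw [norm_mul]
    exact mul_le_mul_of_nonneg_left hx (norm_nonneg _)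
  · filter_upwards [hab] with x hx using hx.const_mul (θ x)

theorem IsWeakPartial.of_tendsto {j : Fin n} {u v : ℕ → 𝔼 n → ℝ} {u₀ v₀ : 𝔼 n → ℝ}
    (h : ∀ N, IsWeakPartial Ω j (u N) (v N)) (hG : LocallyIntegrableOn G Ω)
    (huG : ∀ N, ∀ᵐ x ∂volume.restrict Ω, ‖u N x‖ ≤ G x)
    (hvG : ∀ N, ∀ᵐ x ∂volume.restrict Ω, ‖v N x‖ ≤ G x)
    (hu : ∀ᵐ x ∂volume.restrict Ω, Tendsto (u · x) atTop (𝓝 (u₀ x)))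
    (hv : ∀ᵐ x ∂volume.restrict Ω, Tendsto (v · x) atTop (𝓝 (v₀ x))) :
    IsWeakPartial Ω j u₀ v₀ := by
  refine ⟨locallyIntegrableOn_of_tendsto (fun N => (h N).1) hG huG hu,
    locallyIntegrableOn_of_tendsto (fun N => (h N).2.1) hG hvG hv, fun φ hφ hc hs => ?_⟩
  have hlim := tendsto_setIntegral_mul_of_dominated (fun N => (h N).2.1) hG hvG hv
    hφ.continuous hc hs
  have hlim' := tendsto_setIntegral_mul_of_dominated (fun N => (h N).1) hG huG hu
    (contDiff_partialDeriv hφ (i := j)).continuous (hasCompactSupport_partialDeriv hc j)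
    ((tsupport_partialDeriv_subset j φ).trans hs)
  exact tendsto_nhds_unique hlim (hlim'.neg.congr fun N => ((h N).2.2 φ hφ hc hs).symm)

end DominatedWeakPartial

section Membership

variable {n : ℕ} {p : ℝ} {q : ℝ≥0∞} [Fact (1 ≤ q)] {Ω : TopologicalSpace.Opens (𝔼 n)}

theorem mem_funH_of_contDiffOn [Fact (1 < p)] {φ : 𝔼 n → ℝ} (hφ : ContDiffOn ℝ ∞ φ Ω)
    (h : lorentzENorm p q (volume.restrict Ω) φ < ⊤)
    (h' : lorentzENorm p q (volume.restrict Ω) (gradient φ) < ⊤) : φ ∈ funH p q Ω :=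
  ⟨LorentzPair.ofSmooth hφ h h', subset_closure (LorentzPair.ofSmooth_mem_smoothPairs hφ h h'),
    (LorentzSpace.coeFn_ofFun _ _ h).symm⟩

theorem mem_funW_of_isWeakPartial {u : 𝔼 n → ℝ} {v : Fin n → 𝔼 n → ℝ}
    (hm : AEStronglyMeasurable u (volume.restrict Ω))
    (hu : lorentzENorm p q (volume.restrict Ω) u < ⊤)
    (hv : ∀ j, lorentzENorm p q (volume.restrict Ω) (v j) < ⊤)
    (h : ∀ j, IsWeakPartial Ω j u (v j)) : u ∈ funW p q Ω := by
  have hvm (j : Fin n) := (h j).2.1.aestronglyMeasurable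
  have hu' := LorentzSpace.coeFn_ofFun u hm hu
  have hv' (j : Fin n) := LorentzSpace.coeFn_ofFun (v j) (hvm j) (hv j)
  exact ⟨.toLp 1 (LorentzSpace.ofFun u hm hu,
    .toLp 1 fun j => LorentzSpace.ofFun (v j) (hvm j) (hv j)),
    fun j => (h j).congr hu'.symm (hv' j).symm, hu'.symm⟩

end Membership

section WeakPowerBound

variable {n : ℕ} {p M : ℝ} {y : 𝔼 n} {F : Type*} [NormedAddCommGroup F] {f : 𝔼 n → F}
  {S : Set (𝔼 n)}

/-- The weak `L^p` norm of `dist · y ^ (-n/p)`. -/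
def weakPowerENorm (p : ℝ) (y : 𝔼 n) : ℝ≥0∞ :=
  lorentzENorm p ⊤ volume fun x : 𝔼 n => dist x y ^ (-(n / p) : ℝ)

theorem weakPowerENorm_lt_top [Nonempty (Fin n)] (hp : 1 < p) (y : 𝔼 n) :
    weakPowerENorm p y < ⊤ := by
  have h := lorentzENorm_top_dist_rpow_lt_top volume hp y
  rwa [finrank_euclideanSpace_fin] at h

theorem lorentzENorm_top_le_mul_weakPowerENorm
    (h : ∀ᵐ x ∂volume.restrict S, ‖f x‖ ≤ M * dist x y ^ (-(n / p) : ℝ)) :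
    lorentzENorm p ⊤ (volume.restrict S) f ≤ ‖M‖ₑ * weakPowerENorm p y := by
  have hmono : ∀ᵐ x ∂volume.restrict S,
      ‖f x‖ₑ ≤ ‖(M • fun x => dist x y ^ (-(n / p) : ℝ)) x‖ₑ := by
    filter_upwards [h] with x hx
    exact enorm_le_iff_norm_le.2 (hx.trans (Real.le_norm_self _))
  exact (lorentzENorm_mono_enorm hmono).trans
    ((lorentzENorm_mono_measure Measure.restrict_le_self _).trans (lorentzENorm_smul_le le_top _ _))

theorem lorentzENorm_top_lt_top_of_norm_le [Nonempty (Fin n)] (hp : 1 < p)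
    (h : ∀ᵐ x ∂volume.restrict S, ‖f x‖ ≤ M * dist x y ^ (-(n / p) : ℝ)) :
    lorentzENorm p ⊤ (volume.restrict S) f < ⊤ :=
  (lorentzENorm_top_le_mul_weakPowerENorm h).trans_lt
    (ENNReal.mul_lt_top enorm_lt_top (weakPowerENorm_lt_top hp y))

theorem locallyIntegrable_mul_dist_rpow [Nonempty (Fin n)] (hp : 1 < p) (hM : 0 ≤ M) (y : 𝔼 n) :
    LocallyIntegrable fun x => M * dist x y ^ (-(n / p) : ℝ) := by
  have : Fact (1 < p) := ⟨hp⟩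
  have hm : Measurable fun x : 𝔼 n => M * dist x y ^ (-(n / p) : ℝ) :=
    ((measurable_id.dist measurable_const).pow_const _).const_mul M
  have hfin : lorentzENorm p ⊤ volume (fun x => M * dist x y ^ (-(n / p) : ℝ)) < ⊤ := by
    rw [← Measure.restrict_univ (μ := volume)]
    exact lorentzENorm_top_lt_top_of_norm_le hp
      (.of_forall fun x => (Real.norm_of_nonneg (by positivity)).le)
  exact (LorentzSpace.locallyIntegrable (LorentzSpace.ofFun _ hm.aestronglyMeasurable hfin)).congr
    (LorentzSpace.coeFn_ofFun _ _ hfin)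

end WeakPowerBound

section SeriesMembership

variable {n : ℕ} {p ρ : ℝ} {i : Fin n} {y : 𝔼 n}

theorem norm_partialDeriv_le (j : Fin n) (φ : 𝔼 n → ℝ) (x : 𝔼 n) :
    ‖partialDeriv j φ x‖ ≤ ‖fderiv ℝ φ x‖ :=
  (ContinuousLinearMap.le_opNorm _ _).trans_eq (by rw [PiLp.norm_single, norm_one, mul_one])

theorem ae_restrict_ne [Nonempty (Fin n)] (S : Set (𝔼 n)) (y : 𝔼 n) :
    ∀ᵐ x ∂volume.restrict S, x ≠ y :=
  ae_restrict_of_ae (Measure.ae_ne volume y)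

theorem exists_lorentzENorm_bumpSum_le (hp : 1 < p) (i : Fin n) (y : 𝔼 n) (hρ : 0 < ρ)
    (S : Set (𝔼 n)) :
    ∃ K : ℝ≥0∞, K < ⊤ ∧ ∀ N, lorentzENorm p ⊤ (volume.restrict S) (bumpSum p i y ρ N) ≤ K ∧
      lorentzENorm p ⊤ (volume.restrict S) (gradient (bumpSum p i y ρ N)) ≤ K := by
  have : Nonempty (Fin n) := ⟨i⟩
  obtain ⟨M, -, h⟩ := exists_norm_bumpSum_le (zero_lt_one.trans hp) i y hρ
  refine ⟨‖M‖ₑ * weakPowerENorm p y, ENNReal.mul_lt_top enorm_lt_top (weakPowerENorm_lt_top hp y),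
    fun N => ⟨lorentzENorm_top_le_mul_weakPowerENorm (.of_forall fun x => (h N x).1),
      lorentzENorm_top_le_mul_weakPowerENorm (.of_forall fun x => ?_)⟩⟩
  exact (norm_gradient _ x).trans_le (h N x).2

theorem isWeakPartial_bumpSeries (hp : 1 < p) (i j : Fin n) (y : 𝔼 n) (hρ : 0 < ρ)
    (Ω : TopologicalSpace.Opens (𝔼 n)) :
    IsWeakPartial Ω j (bumpSeries p i y ρ) (partialDeriv j (bumpSeries p i y ρ)) := by
  have : Nonempty (Fin n) := ⟨i⟩
  obtain ⟨M, hM, h⟩ := exists_norm_bumpSum_le (zero_lt_one.trans hp) i y hρ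
  have heq : ∀ᵐ x ∂volume.restrict (Ω : Set (𝔼 n)), ∀ᶠ N in atTop, 3 * radius ρ N < dist x y := by
    filter_upwards [ae_restrict_ne (Ω : Set (𝔼 n)) y] with x hx
    exact eventually_three_mul_radius_lt ρ (dist_pos.2 hx)
  refine .of_tendsto (fun N => isWeakPartial_partialDeriv (contDiff_bumpSum N).contDiffOn)
    ((locallyIntegrable_mul_dist_rpow hp hM y).locallyIntegrableOn _)
    (fun N => .of_forall fun x => (h N x).1)
    (fun N => .of_forall fun x => (norm_partialDeriv_le j _ x).trans (h N x).2) ?_ ?_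
  · filter_upwards [heq] with x hx
    exact tendsto_const_nhds.congr' (hx.mono fun N hN => bumpSeries_eq_bumpSum hρ hN)
  · filter_upwards [heq] with x hx
    refine tendsto_const_nhds.congr' (hx.mono fun N hN => ?_)
    rw [partialDeriv, (bumpSeries_eventuallyEq hρ hN).fderiv_eq]

theorem bumpSeries_mem_funH_puncture [hp : Fact (1 < p)] (i : Fin n) (y : 𝔼 n) (hρ : 0 < ρ)
    (Ω : TopologicalSpace.Opens (𝔼 n)) : bumpSeries p i y ρ ∈ funH p ⊤ (puncture Ω y) := by
  have : Nonempty (Fin n) := ⟨i⟩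
  obtain ⟨M, -, h⟩ := exists_norm_bumpSeries_le (zero_lt_one.trans hp.out) i y hρ
  exact mem_funH_of_contDiffOn
    (contDiffOn_bumpSeries hρ (notMem_sdiff_of_mem (mem_singleton y)))
    (lorentzENorm_top_lt_top_of_norm_le hp.out
      ((ae_restrict_ne _ y).mono fun x hx => (h x hx).1))
    (lorentzENorm_top_lt_top_of_norm_le hp.out
      ((ae_restrict_ne _ y).mono fun x hx => (norm_gradient _ x).trans_le (h x hx).2))

theorem bumpSeries_mem_funW (hp : 1 < p) (i : Fin n) (y : 𝔼 n) (hρ : 0 < ρ)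
    (Ω : TopologicalSpace.Opens (𝔼 n)) : bumpSeries p i y ρ ∈ funW p ⊤ Ω := by
  have : Nonempty (Fin n) := ⟨i⟩
  obtain ⟨M, -, h⟩ := exists_norm_bumpSeries_le (zero_lt_one.trans hp) i y hρ
  have hweak (j : Fin n) := isWeakPartial_bumpSeries hp i j y hρ Ω
  exact mem_funW_of_isWeakPartial (hweak i).1.aestronglyMeasurable
    (lorentzENorm_top_lt_top_of_norm_le hp
      ((ae_restrict_ne _ y).mono fun x hx => (h x hx).1))
    (fun j => lorentzENorm_top_lt_top_of_norm_le hp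
      ((ae_restrict_ne _ y).mono fun x hx => (norm_partialDeriv_le j _ x).trans (h x hx).2)) hweak

end SeriesMembership

section Decay

variable {n : ℕ} {p ρ : ℝ} {y : 𝔼 n} {Ω : TopologicalSpace.Opens (𝔼 n)}

theorem tendsto_setIntegral_concWeight_mul_of_continuousAt (hp : 0 < p) {f : 𝔼 n → ℝ}
    (hf : ContinuousAt f y) (i : Fin n) (S : Set (𝔼 n)) :
    Tendsto (fun r => ∫ x in S, concWeight p i y r x * f x) (𝓝[>] 0) (𝓝 0) := by
  have hn : (0 : ℝ) < n := Nat.cast_pos.2 i.pos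
  obtain ⟨ε, hε, hfε⟩ := Metric.nhds_basis_closedBall.mem_iff.1 <|
    hf.norm.eventually_le_const (lt_add_one ‖f y‖)
  have hlim : Tendsto (fun r : ℝ =>
      r ^ (n / p : ℝ) * (∫ z, ‖partialDeriv i (annulusBump i) z‖) * (‖f y‖ + 1))
      (𝓝[>] 0) (𝓝 0) := by
    have hpow := (Real.continuousAt_rpow_const 0 (n / p : ℝ) (.inr (by positivity))).tendsto
    rw [Real.zero_rpow (by positivity)] at hpow
    simpa only [zero_mul] using
      ((hpow.mono_left nhdsWithin_le_nhds).mul_const _).mul_const (‖f y‖ + 1)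
  refine squeeze_zero_norm' ?_ hlim
  filter_upwards [Ioo_mem_nhdsGT (show 0 < ε / 3 by positivity)] with r hr
  have hle (x : 𝔼 n) : ‖concWeight p i y r x * f x‖ ≤ ‖concWeight p i y r x‖ * (‖f y‖ + 1) := by
    by_cases hx : x ∈ tsupport (concWeight p i y r)
    · rw [norm_mul]
      refine mul_le_mul_of_nonneg_left (hfε ?_) (norm_nonneg _)
      exact Metric.closedBall_subset_closedBall (by linarith [hr.2])
        (annulus_subset_closedBall (tsupport_concWeight_subset hr.1 hx))
    · simp [image_eq_zero_of_notMem_tsupport hx]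
  have hint : Integrable fun x => ‖concWeight p i y r x‖ * (‖f y‖ + 1) :=
    ((contDiff_concWeight.continuous.integrable_of_hasCompactSupport
      (hasCompactSupport_concWeight hr.1)).norm).mul_const _
  calc ‖∫ x in S, concWeight p i y r x * f x‖
      ≤ ∫ x in S, ‖concWeight p i y r x‖ * (‖f y‖ + 1) :=
        norm_integral_le_of_norm_le hint.integrableOn (.of_forall hle)
    _ ≤ ∫ x, ‖concWeight p i y r x‖ * (‖f y‖ + 1) :=
        setIntegral_le_integral hint (.of_forall fun x => by positivity)
    _ = _ := by rw [integral_mul_const, integral_norm_concWeight hr.1]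

variable [hp : Fact (1 < p)]

theorem tendsto_concFunctional_component (hρ : 0 < ρ) (hy : y ∈ Ω) {w : LorentzPair p ⊤ Ω}
    (hw : w ∈ SobolevLorentzH p ⊤ Ω) (i : Fin n) :
    Tendsto (fun k => concFunctional p i y (radius_pos hρ k) Ω (LorentzPair.component p ⊤ Ω i w))
      atTop (𝓝 0) := by
  obtain ⟨C, hC⟩ := exists_norm_concFunctional_le p i y Ω
  refine tendsto_zero_of_mem_closure
    (f := fun k => concFunctional p i y (radius_pos hρ k) Ω ∘L LorentzPair.component p ⊤ Ω i)
    ⟨C * ‖LorentzPair.component p ⊤ Ω i‖, fun k => ?_⟩ ?_ hw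
  · exact (ContinuousLinearMap.opNorm_comp_le _ _).trans
      (mul_le_mul_of_nonneg_right (hC _ _) (norm_nonneg _))
  · rintro v ⟨φ, hφ, -, hv⟩
    have hcont : ContinuousAt (partialDeriv i φ) y :=
      (continuousOn_partialDeriv hφ).continuousAt (Ω.isOpen.mem_nhds hy)
    refine ((tendsto_setIntegral_concWeight_mul_of_continuousAt (zero_lt_one.trans hp.out)
      hcont i Ω).comp (tendsto_radius_nhdsGT hρ)).congr fun k => ?_
    exact (concFunctional_apply_of_ae_eq (radius_pos hρ k)
      (LorentzPair.component_ae_eq_partialDeriv hv i)).symm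

theorem tendsto_concFunctional_toWeak {q : ℝ≥0∞} [hq : Fact (1 ≤ q)] (hqt : q ≠ ⊤) (hρ : 0 < ρ)
    (i : Fin n) (v : LorentzOn p q Ω ℝ) :
    Tendsto (fun k => concFunctional p i y (radius_pos hρ k) Ω (LorentzSpace.toWeak le_rfl v))
      atTop (𝓝 0) := by
  obtain ⟨C, hC⟩ := exists_enorm_setIntegral_concWeight_mul_le p i y
  have hn : n ≠ 0 := i.pos.ne'
  have hvol : Tendsto (fun k => radius ρ k ^ n * outerVolume n) atTop (𝓝[>] 0) := by
    refine tendsto_nhdsWithin_iff.2 ⟨?_, .of_forall fun k =>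
      mul_pos (pow_pos (radius_pos hρ k) n) (outerVolume_pos n)⟩
    simpa only [zero_pow hn, zero_mul] using
      ((tendsto_radius ρ).pow n).mul_const (outerVolume n)
  have hlim := ENNReal.Tendsto.const_mul ((tendsto_lorentzProfile_zero
    (zero_lt_one.trans hp.out) hq.out hqt v.2.ne).comp hvol) (.inr (ENNReal.ofReal_ne_top (r := C)))
  rw [mul_zero] at hlim
  refine tendsto_zero_iff_enorm_tendsto_zero.2 <| tendsto_of_tendsto_of_tendsto_of_le_of_le
    tendsto_const_nhds hlim (fun _ => zero_le) fun k => ?_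
  rw [concFunctional_apply_of_ae_eq _ (LorentzSpace.coeFn_toWeak le_rfl v)]
  exact hC _ (radius_pos hρ k) Ω v.1 v.1.aestronglyMeasurable.aemeasurable

end Decay

section Separation

variable {n : ℕ} {p ρ : ℝ} [hp : Fact (1 < p)] {i : Fin n} {y : 𝔼 n}
  {Ω : TopologicalSpace.Opens (𝔼 n)}

theorem concFunctional_component_eq_bumpEnergy (hρ : 0 < ρ) {k : ℕ}
    (hs : annulus y (radius ρ k) ⊆ Ω) {w : LorentzPair p ⊤ Ω} (hw : w ∈ SobolevLorentzH p ⊤ Ω)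
    (hu : bumpSeries p i y ρ =ᵐ[volume.restrict Ω] w.fst.1) :
    concFunctional p i y (radius_pos hρ k) Ω (LorentzPair.component p ⊤ Ω i w) =
      bumpEnergy i := by
  have hr := radius_pos hρ k
  have hsub : tsupport (concWeight p i y (radius ρ k)) ⊆ annulus y (radius ρ k) :=
    tsupport_concWeight_subset hr
  have hc : HasCompactSupport (concWeight p i y (radius ρ k)) := hasCompactSupport_concWeight hr
  have hparts := ((isWeakPartial_component hw i).congr hu.symm .rfl).2.2 _ contDiff_concWeight hc
    (hsub.trans hs)
  have hparts' := (isWeakPartial_partialDeriv (Ω := Ω) (i := i)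
    (contDiff_concBump (p := p) (i := i) (y := y) (r := radius ρ k)).contDiffOn).2.2 _
    contDiff_concWeight hc (hsub.trans hs)
  have hcongr (x : 𝔼 n) : partialDeriv i (concWeight p i y (radius ρ k)) x * bumpSeries p i y ρ x =
      partialDeriv i (concWeight p i y (radius ρ k)) x * concBump p i y (radius ρ k) x := by
    by_cases hx : x ∈ annulus y (radius ρ k)
    · rw [bumpSeries_eq_concBump hρ hx]
    · rw [image_eq_zero_of_notMem_tsupport fun h =>
        hx (hsub (tsupport_partialDeriv_subset i _ h)), zero_mul, zero_mul]
  calc concFunctional p i y hr Ω (LorentzPair.component p ⊤ Ω i w)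
      = ∫ x in Ω, concWeight p i y (radius ρ k) x * (LorentzPair.component p ⊤ Ω i w).1 x :=
        concFunctional_apply_of_ae_eq hr .rfl
    _ = -∫ x in Ω, partialDeriv i (concWeight p i y (radius ρ k)) x * bumpSeries p i y ρ x :=
        hparts
    _ = ∫ x in Ω, concWeight p i y (radius ρ k) x *
          partialDeriv i (concBump p i y (radius ρ k)) x := by simp only [hcongr, hparts']
    _ = bumpEnergy i := by
        rw [setIntegral_mul_of_tsupport_subset (hsub.trans hs),
          integral_concWeight_mul_partialDeriv_concBump hr]

theorem not_tendsto_concFunctional_component (hρ : 0 < ρ)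
    (hs : ∀ k, annulus y (radius ρ k) ⊆ Ω) {w : LorentzPair p ⊤ Ω}
    (hw : w ∈ SobolevLorentzH p ⊤ Ω) (hu : bumpSeries p i y ρ =ᵐ[volume.restrict Ω] w.fst.1) :
    ¬ Tendsto (fun k => concFunctional p i y (radius_pos hρ k) Ω
      (LorentzPair.component p ⊤ Ω i w)) atTop (𝓝 0) := fun h =>
  (bumpEnergy_pos i).ne' <| tendsto_nhds_unique (tendsto_const_nhds.congr fun k =>
    (concFunctional_component_eq_bumpEnergy hρ (hs k) hw hu).symm) h

theorem bumpSeries_notMem_funH_top (hρ : 0 < ρ) (hΩ : Metric.closedBall y (3 * ρ) ⊆ Ω) :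
    bumpSeries p i y ρ ∉ funH p ⊤ Ω := by
  rintro ⟨w, hw, hu⟩
  exact not_tendsto_concFunctional_component hρ (annulus_radius_subset hρ.le hΩ) hw hu
    (tendsto_concFunctional_component hρ (hΩ (Metric.mem_closedBall_self (by positivity))) hw i)

theorem bumpSeries_notMem_funH_puncture {q : ℝ≥0∞} [Fact (1 ≤ q)] (hq : q ≠ ⊤) (hρ : 0 < ρ)
    (hΩ : Metric.closedBall y (3 * ρ) ⊆ Ω) : bumpSeries p i y ρ ∉ funH p q (puncture Ω y) := by
  rintro ⟨w, hw, hu⟩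
  have hs (k : ℕ) : annulus y (radius ρ k) ⊆ (puncture Ω y : Set (𝔼 n)) := fun x hx =>
    ⟨annulus_radius_subset hρ.le hΩ k hx,
      ne_of_mem_of_not_mem hx (notMem_annulus_self (radius_pos hρ k))⟩
  refine not_tendsto_concFunctional_component hρ hs
    (LorentzPair.toWeak_mem_sobolevLorentzH le_rfl hw) (hu.trans ?_) ?_
  · rw [LorentzPair.fst_toWeak]
    exact (LorentzSpace.coeFn_toWeak _ w.fst).symm
  · simp only [LorentzPair.component_toWeak]
    exact tendsto_concFunctional_toWeak hq hρ i _

end Separation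

section NonReflexivity

variable {n : ℕ} {p ρ : ℝ} {i : Fin n} {y : 𝔼 n} {Ω : TopologicalSpace.Opens (𝔼 n)}

theorem concWeight_mul_partialDeriv_concBump_eq_zero (hρ : 0 < ρ) {j k : ℕ} (hjk : j ≠ k)
    (x : 𝔼 n) : concWeight p i y (radius ρ k) x *
      partialDeriv i (concBump p i y (radius ρ j)) x = 0 := by
  by_contra hne
  obtain ⟨hw, hb⟩ := mul_ne_zero_iff.1 hne
  exact hjk <| eq_of_mem_annulus hρ
    (tsupport_concBump_subset (radius_pos hρ j)
      (tsupport_partialDeriv_subset i _ (subset_tsupport _ hb)))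
    (tsupport_concWeight_subset (radius_pos hρ k) (subset_tsupport _ hw))

theorem setIntegral_concWeight_mul_partialDeriv_bumpSum (hρ : 0 < ρ) {k : ℕ}
    (hs : annulus y (radius ρ k) ⊆ Ω) (N : ℕ) :
    ∫ x in Ω, concWeight p i y (radius ρ k) x * partialDeriv i (bumpSum p i y ρ N) x =
      if k < N then bumpEnergy i else 0 := by
  have hr := radius_pos hρ k
  have hterm (j : ℕ) : ∫ x, concWeight p i y (radius ρ k) x *
      partialDeriv i (concBump p i y (radius ρ j)) x = if j = k then bumpEnergy i else 0 := by
    split_ifs with hjk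
    · rw [hjk, integral_concWeight_mul_partialDeriv_concBump hr]
    · simp only [concWeight_mul_partialDeriv_concBump_eq_zero hρ hjk, integral_zero]
  have hint (j : ℕ) : Integrable fun x => concWeight p i y (radius ρ k) x *
      partialDeriv i (concBump p i y (radius ρ j)) x :=
    (contDiff_concWeight.continuous.mul
      (contDiff_partialDeriv contDiff_concBump).continuous).integrable_of_hasCompactSupport
      (hasCompactSupport_concWeight hr).mul_right
  have hsum (x : 𝔼 n) : partialDeriv i (bumpSum p i y ρ N) x =
      ∑ j ∈ Finset.range N, partialDeriv i (concBump p i y (radius ρ j)) x := by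
    simp only [partialDeriv, fderiv_bumpSum, sum_apply]
  rw [setIntegral_mul_of_tsupport_subset ((tsupport_concWeight_subset hr).trans hs)]
  simp only [hsum, Finset.mul_sum]
  rw [integral_finsetSum _ fun j _ => hint j]
  simp only [hterm, Finset.sum_ite_eq', Finset.mem_range]

variable [hp : Fact (1 < p)]

theorem exists_bumpSum_sobolevLorentzH0 (hρ : 0 < ρ) (hΩ : Metric.closedBall y (3 * ρ) ⊆ Ω)
    (i : Fin n) : ∃ (s : ℕ → SobolevLorentzH0 p ⊤ Ω) (B : ℝ), ∀ N, ‖s N‖ ≤ B ∧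
      (s N).1.snd.1 =ᵐ[volume.restrict Ω] gradient (bumpSum p i y ρ N) := by
  obtain ⟨K, hK, hle⟩ := exists_lorentzENorm_bumpSum_le hp.out i y hρ (Ω : Set (𝔼 n))
  have hφ (N : ℕ) : ContDiffOn ℝ ∞ (bumpSum p i y ρ N) Ω := (contDiff_bumpSum N).contDiffOn
  have h1 (N : ℕ) := (hle N).1.trans_lt hK
  have h2 (N : ℕ) := (hle N).2.trans_lt hK
  let s (N : ℕ) : LorentzPair p ⊤ Ω := .ofSmooth (hφ N) (h1 N) (h2 N)
  have hs (N : ℕ) : s N ∈ testPairs p ⊤ Ω := ⟨_, contDiff_bumpSum N, hasCompactSupport_bumpSum hρ N,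
    (tsupport_bumpSum_subset hρ N).trans hΩ, LorentzSpace.coeFn_ofFun _ _ (h1 N),
    LorentzSpace.coeFn_ofFun _ _ (h2 N)⟩
  refine ⟨fun N => ⟨s N, subset_closure (hs N)⟩, K.toReal + K.toReal, fun N =>
    ⟨(norm_withLp_prod_le _).trans (add_le_add ?_ ?_), LorentzSpace.coeFn_ofFun _ _ (h2 N)⟩⟩
  · rw [← toReal_enorm]
    exact ENNReal.toReal_mono hK.ne ((LorentzSpace.enorm_ofFun _ _ (h1 N)).trans_le (hle N).1)
  · rw [← toReal_enorm]
    exact ENNReal.toReal_mono hK.ne ((LorentzSpace.enorm_ofFun _ _ (h2 N)).trans_le (hle N).2)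

theorem not_isReflexiveSpace_of_component_eq {X : Type*} [NormedAddCommGroup X] [NormedSpace ℝ X]
    (hρ : 0 < ρ) (hΩ : Metric.closedBall y (3 * ρ) ⊆ Ω) (J : SobolevLorentzH0 p ⊤ Ω →L[ℝ] X)
    (D : X →L[ℝ] LorentzOn p ⊤ Ω ℝ) (hD : ∀ w, D (J w) = LorentzPair.component p ⊤ Ω i w) :
    ¬ IsReflexiveSpace X := by
  obtain ⟨s, B, hs⟩ := exists_bumpSum_sobolevLorentzH0 (p := p) hρ hΩ i
  obtain ⟨C, hC⟩ := exists_norm_concFunctional_le p i y Ω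
  have hval (k N : ℕ) : (concFunctional p i y (radius_pos hρ k) Ω ∘L D) (J (s N)) =
      if k < N then bumpEnergy i else 0 := by
    rw [← setIntegral_concWeight_mul_partialDeriv_bumpSum (p := p) hρ
      (annulus_radius_subset hρ.le hΩ k), ContinuousLinearMap.comp_apply, hD]
    exact concFunctional_apply_of_ae_eq _ (LorentzPair.component_ae_eq_partialDeriv (hs N).2 i)
  refine not_isReflexiveSpace_of_tendsto (s := fun N => J (s N))
    (f := fun k => concFunctional p i y (radius_pos hρ k) Ω ∘L D) (B := ‖J‖ * B)
    (fun N => J.le_opNorm_of_le (hs N).1) ⟨C * ‖D‖, fun k => ?_⟩ (bumpEnergy_pos i).ne'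
    (fun k => ?_) fun N => ?_
  · exact (ContinuousLinearMap.opNorm_comp_le _ _).trans
      (mul_le_mul_of_nonneg_right (hC _ _) (norm_nonneg _))
  · refine tendsto_const_nhds.congr' ((eventually_gt_atTop k).mono fun N hN => ?_)
    exact ((hval k N).trans (if_pos hN)).symm
  · refine tendsto_const_nhds.congr' ((eventually_ge_atTop N).mono fun k hk => ?_)
    exact ((hval k N).trans (if_neg hk.not_gt)).symm

/-- The inclusion `H_0^{1,(p,∞)}(Ω) → H^{1,(p,∞)}(Ω)`. -/
def SobolevLorentzH0.toH : SobolevLorentzH0 p ⊤ Ω →L[ℝ] SobolevLorentzH p ⊤ Ω :=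
  (SobolevLorentzH0 p ⊤ Ω).subtypeL.codRestrict _ fun w =>
    Submodule.topologicalClosure_mono testPairs_le_smoothPairs w.2

theorem not_isReflexiveSpace_sobolevLorentzH0 (hρ : 0 < ρ)
    (hΩ : Metric.closedBall y (3 * ρ) ⊆ Ω) (i : Fin n) :
    ¬ IsReflexiveSpace (SobolevLorentzH0 p ⊤ Ω) :=
  not_isReflexiveSpace_of_component_eq hρ hΩ (.id ℝ _)
    (LorentzPair.component p ⊤ Ω i ∘L (SobolevLorentzH0 p ⊤ Ω).subtypeL) fun _ => rfl

theorem not_isReflexiveSpace_sobolevLorentzH (hρ : 0 < ρ)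
    (hΩ : Metric.closedBall y (3 * ρ) ⊆ Ω) (i : Fin n) :
    ¬ IsReflexiveSpace (SobolevLorentzH p ⊤ Ω) :=
  not_isReflexiveSpace_of_component_eq hρ hΩ SobolevLorentzH0.toH
    (LorentzPair.component p ⊤ Ω i ∘L (SobolevLorentzH p ⊤ Ω).subtypeL) fun _ => rfl

theorem not_isReflexiveSpace_sobolevLorentzW (hρ : 0 < ρ)
    (hΩ : Metric.closedBall y (3 * ρ) ⊆ Ω) (i : Fin n) :
    ¬ IsReflexiveSpace (SobolevLorentzW p ⊤ Ω) :=
  not_isReflexiveSpace_of_component_eq hρ hΩ (SobolevLorentzH.toW ∘L SobolevLorentzH0.toH)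
    (PiLp.proj 1 (fun _ : Fin n => LorentzOn p ⊤ Ω ℝ) i ∘L WithLp.sndL _ ℝ _ _ ∘L
      (SobolevLorentzW p ⊤ Ω).subtypeL) fun _ => rfl

end NonReflexivity

theorem exists_closedBall_three_mul_subset {X : Type*} [PseudoMetricSpace X] {U : Set X} {y : X}
    (hU : U ∈ 𝓝 y) : ∃ ρ > 0, Metric.closedBall y (3 * ρ) ⊆ U := by
  obtain ⟨ε, hε, h⟩ := Metric.nhds_basis_closedBall.mem_iff.1 hU
  exact ⟨ε / 3, by positivity, by rwa [mul_div_cancel₀ _ three_ne_zero]⟩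

end

theorem mainTheorem4 (n : ℕ) (hn : 1 ≤ n) (p : ℝ) [Fact (1 < p)]
    (Ω : TopologicalSpace.Opens (EuclideanSpace ℝ (Fin n)))
    (y : EuclideanSpace ℝ (Fin n)) (hy : y ∈ Ω) :
    (funH p ⊤ Ω ⊂ funW p ⊤ Ω ∩ funH p ⊤ (puncture Ω y)) ∧
    (∀ (q : ℝ≥0∞) [Fact (1 ≤ q)], q ≠ ⊤ → funH p q (puncture Ω y) ⊂ funH p ⊤ (puncture Ω y)) ∧
    (¬ IsReflexiveSpace (SobolevLorentzH0 p ⊤ Ω)) ∧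
    (¬ IsReflexiveSpace (SobolevLorentzH p ⊤ Ω)) ∧
    (¬ IsReflexiveSpace (SobolevLorentzW p ⊤ Ω)) := by
  obtain ⟨ρ, hρ, hΩ⟩ := exists_closedBall_three_mul_subset (Ω.isOpen.mem_nhds hy)
  let i : Fin n := ⟨0, hn⟩
  have hW := bumpSeries_mem_funW (Fact.out : 1 < p) i y hρ Ω
  have hH := bumpSeries_mem_funH_puncture (p := p) i y hρ Ω
  refine ⟨(ssubset_iff_of_subset ?_).2 ⟨_, ⟨hW, hH⟩, bumpSeries_notMem_funH_top hρ hΩ⟩,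
    fun q _ hq => (ssubset_iff_of_subset (funH_subset_funH_top le_rfl)).2
      ⟨_, hH, bumpSeries_notMem_funH_puncture hq hρ hΩ⟩,
    not_isReflexiveSpace_sobolevLorentzH0 hρ hΩ i, not_isReflexiveSpace_sobolevLorentzH hρ hΩ i,
    not_isReflexiveSpace_sobolevLorentzW hρ hΩ i⟩
  exact subset_inter funH_subset_funW (funH_subset_funH_top sdiff_subset)
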